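/- Let $M_1,M_2$ be non-empty smooth (Hausdorff, finite-dimensional) manifolds with Poisson tensors $\Pi_1,\Pi_2$ and Riemannian (positive definite) metrics $\bar g_1,\bar g_2$. Let $f_1$ be a positive smooth Casimir function on $(M_1,\Pi_1)$, that is, $\Pi_1(df_1,dh)=0$ for all $h\in C^\infty(M_1)$, and let $\nu_1$ be a non-zero constant. On $M=M_1\times M_2$, with projections $\pi_1,\pi_2$, consider the warped metric $\bar g^{f_1}=\pi_1^*\bar g_1+(f_1\circ\pi_1)^2\,\pi_2^*\bar g_2$ and the bivector field $\Pi^{\nu_1}=\Pi_1+\nu_1\Pi_2$. For a manifold with a Poisson tensor $\Pi$ and a Riemannian metric with cometric $\tilde g$, put $\beta(\sharp\alpha)=\Pi(\alpha,\beta)$ and $[\alpha,\beta]_\Pi=\mathcal L_{\sharp\alpha}\beta-\mathcal L_{\sharp\beta}\alpha-d(\Pi(\alpha,\beta))$ for one-forms $\alpha,\beta$. Let $\mathcal D$ be the contravariant Levi-Civita connection, i.e. the unique contravariant connection with $\mathcal D_\alpha\beta-\mathcal D_\beta\alpha=[\alpha,\beta]_\Pi$ and $\sharp\alpha\,(\tilde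 g(\beta,\gamma))=\tilde g(\mathcal D_\alpha\beta,\gamma)+\tilde g(\beta,\mathcal D_\alpha\gamma)$, and let $\mathcal R(\alpha,\beta)\gamma=\mathcal D_\alpha\mathcal D_\beta\gamma-\mathcal D_\beta\mathcal D_\alpha\gamma-\mathcal D_{[\alpha,\beta]_\Pi}\gamma$. The sectional curvature at a point, for linearly independent covectors $\omega,\eta$ there, is $$\mathcal K(\omega,\eta)=\frac{\tilde g(\mathcal R(\omega,\eta)\eta,\omega)}{\tilde g(\omega,\omega)\,\tilde g(\eta,\eta)-\tilde g(\omega,\eta)^2}.$$ Then $(M,\Pi^{\nu_1},\bar g^{f_1})$ has non-negative sectional curvature (at all points and for all pairs of linearly independent covectors) if and only if both $(M_1,\Pi_1,\bar g_1)$ and $(M_2,\Pi_2,\bar g_2)$ have non-negative sectional curvature. Likewise, $(M,\Pi^{\nu_1},\bar g^{f_1})$ has non-positive sectional curvature if and only if both $(M_1,\Pi_1,\bar g_1)$ and $(M_2,\Pi_2,\bar g_2)$ do. -/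

import Mathlib

open scoped Manifold ContDiff

noncomputable section

namespace ContravariantGeometry

/-! ## Contravariant geometry on (an open subset of) a vector space

`P` is a bivector field, given by its sharp map `♯_P : V* → V` at every point
(`P(θ, η) = η (♯_P θ)`), and `g` is a field of metrics. One-forms are functions `V → V*`. -/

section Local

variable {V : Type*} [NormedAddCommGroup V] [NormedSpace ℝ V]

/-- The vector field `♯_P(α)`. -/
def anchor (P : V → (V →L[ℝ] ℝ) →L[ℝ] V) (α : V → V →L[ℝ] ℝ) : V → V :=
  fun y => P y (α y)

/-- The function `P(α, β) = β(♯_P(α))`. -/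
def bivectorPairing (P : V → (V →L[ℝ] ℝ) →L[ℝ] V) (α β : V → V →L[ℝ] ℝ) : V → ℝ :=
  fun y => β y (anchor P α y)

/-- The Lie derivative of the one-form `β` along the vector field `X`:
`(L_X β)(v) = (∂_X β)(v) + β(∂_v X)`. -/
def lieDerivForm (X : V → V) (β : V → V →L[ℝ] ℝ) : V → V →L[ℝ] ℝ :=
  fun y => fderiv ℝ β y (X y) + (β y).comp (fderiv ℝ X y)

/-- The Lie bracket of one-forms `[α, β]_P = L_{♯α} β - L_{♯β} α - d(P(α, β))`. -/
def formBracket (P : V → (V →L[ℝ] ℝ) →L[ℝ] V) (α β : V → V →L[ℝ] ℝ) : V → V →L[ℝ] ℝ :=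
  fun y => lieDerivForm (anchor P α) β y - lieDerivForm (anchor P β) α y
    - fderiv ℝ (bivectorPairing P α β) y

/-- The cometric of a metric `b`: `θ, η ↦ b(♯_b θ, ♯_b η)`, where `♯_b : V* → V` is the inverse of
the musical isomorphism `v ↦ b(v, ·)`. -/
def cometric (b : V →L[ℝ] V →L[ℝ] ℝ) (θ η : V →L[ℝ] ℝ) : ℝ :=
  b (b.inverse θ) (b.inverse η)

/-- The function `g̃(α, β)` for one-forms `α`, `β`. -/
def cometricPairing (g : V → V →L[ℝ] V →L[ℝ] ℝ) (α β : V → V →L[ℝ] ℝ) : V → ℝ :=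
  fun y => cometric (g y) (α y) (β y)

/-- The right-hand side of the Koszul formula
`2 g̃(D_α β, γ) = ♯α(g̃(β, γ)) + ♯β(g̃(α, γ)) - ♯γ(g̃(α, β))
  + g̃([α, β], γ) + g̃([γ, α], β) + g̃([γ, β], α)`. -/
def koszul (P : V → (V →L[ℝ] ℝ) →L[ℝ] V) (g : V → V →L[ℝ] V →L[ℝ] ℝ)
    (α β γ : V → V →L[ℝ] ℝ) : V → ℝ :=
  fun y => fderiv ℝ (cometricPairing g β γ) y (anchor P α y)
    + fderiv ℝ (cometricPairing g α γ) y (anchor P β y)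
    - fderiv ℝ (cometricPairing g α β) y (anchor P γ y)
    + cometricPairing g (formBracket P α β) γ y
    + cometricPairing g (formBracket P γ α) β y
    + cometricPairing g (formBracket P γ β) α y

variable [FiniteDimensional ℝ V]

/-- The contravariant Levi-Civita connection `D_α β` of `(P, g̃)`, i.e. the one-form determined by
the Koszul formula. Since `g̃(θ, g(e, ·)) = θ(e)`, its component `(D_α β)(e_i)` along a vector `e_i`
of a basis is half of the Koszul expression at `γ = g(e_i, ·)`. -/
def leviCivita (P : V → (V →L[ℝ] ℝ) →L[ℝ] V) (g : V → V →L[ℝ] V →L[ℝ] ℝ)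
    (α β : V → V →L[ℝ] ℝ) : V → V →L[ℝ] ℝ :=
  fun y => ∑ i, ((1 / 2 : ℝ) * koszul P g α β (fun z => g z (Module.finBasis ℝ V i)) y) •
    ((Module.finBasis ℝ V).coord i).toContinuousLinearMap

/-- The contravariant curvature `R(α, β)γ = D_α D_β γ - D_β D_α γ - D_{[α, β]} γ`. -/
def curvature (P : V → (V →L[ℝ] ℝ) →L[ℝ] V) (g : V → V →L[ℝ] V →L[ℝ] ℝ)
    (α β γ : V → V →L[ℝ] ℝ) : V → V →L[ℝ] ℝ :=
  fun y => leviCivita P g α (leviCivita P g β γ) y - leviCivita P g β (leviCivita P g α γ) y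
    - leviCivita P g (formBracket P α β) γ y

/-- The sectional curvature at `y` of covectors `ξ`, `ζ` (extended to constant one-forms):
`g̃(R(ξ, ζ)ζ, ξ) / (g̃(ξ, ξ) g̃(ζ, ζ) - g̃(ξ, ζ)²)`. -/
def localSectionalCurvature (P : V → (V →L[ℝ] ℝ) →L[ℝ] V) (g : V → V →L[ℝ] V →L[ℝ] ℝ)
    (y : V) (ξ ζ : V →L[ℝ] ℝ) : ℝ :=
  cometric (g y) (curvature P g (fun _ => ξ) (fun _ => ζ) (fun _ => ζ) y) ξ /
    (cometric (g y) ξ ξ * cometric (g y) ζ ζ - cometric (g y) ξ ζ ^ 2)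

end Local

/-- The pull-back `u, v ↦ b(A u, A v)` of a bilinear form `b` under a linear map `A`. -/
def pullbackForm {V W : Type*} [TopologicalSpace V] [AddCommGroup V] [Module ℝ V]
    [TopologicalSpace W] [AddCommGroup W] [Module ℝ W]
    (A : V →L[ℝ] W) (b : W →L[ℝ] W →L[ℝ] ℝ) : V →L[ℝ] V →L[ℝ] ℝ :=
  (A.precomp ℝ).comp (b.comp A)

/-! ## Manifolds -/

section Manifold

variable {E : Type*} [NormedAddCommGroup E] [NormedSpace ℝ E]
  {H : Type*} [TopologicalSpace H] (I : ModelWithCorners ℝ E H)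
  {M : Type*} [TopologicalSpace M] [ChartedSpace H M]

/-- Covectors at `x`. -/
abbrev Covector (x : M) : Type _ := TangentSpace I x →L[ℝ] ℝ

variable (M) in
/-- A field of linear maps `♯ : T*M → TM`. When it is skew (see `IsPoisson`) this is the same thing
as a bivector field `P`, through `P(θ, η) = η(♯θ)`. -/
abbrev SharpField : Type _ := ∀ x : M, Covector I x →L[ℝ] TangentSpace I x

variable (M) in
/-- A field of bilinear forms on the tangent spaces. -/
abbrev MetricField : Type _ := ∀ x : M, TangentSpace I x →L[ℝ] TangentSpace I x →L[ℝ] ℝ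

/-- The differential of a real function. -/
def differential (f : M → ℝ) (x : M) : Covector I x := mfderiv I 𝓘(ℝ, ℝ) f x

/-- The bracket `{f, h} = P(df, dh)`. -/
def poissonBracket (P : SharpField I M) (f h : M → ℝ) : M → ℝ :=
  fun x => differential I h x (P x (differential I f x))

/-- The derivative `T_x M → E` of the preferred chart at `p`, at the point `x` with coordinates
`y`. -/
def chartDeriv (p : M) (y : E) : TangentSpace I ((extChartAt I p).symm y) →L[ℝ] E :=
  mfderiv I 𝓘(ℝ, E) (extChartAt I p) ((extChartAt I p).symm y)

/-- The expression of a bivector field in the chart at `p`. -/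
def localSharp (P : SharpField I M) (p : M) (y : E) : (E →L[ℝ] ℝ) →L[ℝ] E :=
  (chartDeriv I p y).comp ((P ((extChartAt I p).symm y)).comp ((chartDeriv I p y).precomp ℝ))

/-- The expression of a metric in the chart at `p`. -/
def localMetric (g : MetricField I M) (p : M) (y : E) : E →L[ℝ] E →L[ℝ] ℝ :=
  pullbackForm (chartDeriv I p y).inverse (g ((extChartAt I p).symm y))

/-- `P` is a Poisson tensor: a skew field, smooth in the charts, whose bracket of functions
satisfies the Jacobi identity. -/
structure IsPoisson (P : SharpField I M) : Prop where
  skew : ∀ (x : M) (θ η : Covector I x), η (P x θ) = -θ (P x η)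
  smooth : ∀ p : M, ContDiffOn ℝ ∞ (localSharp I P p) (extChartAt I p).target
  jacobi : ∀ f h k : M → ℝ, ContMDiff I 𝓘(ℝ, ℝ) ∞ f → ContMDiff I 𝓘(ℝ, ℝ) ∞ h →
    ContMDiff I 𝓘(ℝ, ℝ) ∞ k → ∀ x : M,
      poissonBracket I P (poissonBracket I P f h) k x
        + poissonBracket I P (poissonBracket I P h k) f x
        + poissonBracket I P (poissonBracket I P k f) h x = 0

/-- `f` is a Casimir function of `P`: `{f, h} = 0` for every smooth function `h`. -/
def IsCasimir (P : SharpField I M) (f : M → ℝ) : Prop :=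
  ∀ h : M → ℝ, ContMDiff I 𝓘(ℝ, ℝ) ∞ h → ∀ x : M, poissonBracket I P f h x = 0

variable [FiniteDimensional ℝ E]

/-- The contravariant sectional curvature of `(P, g̃)` at `p` on the plane spanned by the covectors
`θ`, `η`, computed in the chart at `p`. -/
def sectionalCurvature (P : SharpField I M) (g : MetricField I M) (p : M) (θ η : Covector I p) :
    ℝ :=
  localSectionalCurvature (localSharp I P p) (localMetric I g p) (extChartAt I p p)
    (θ.comp (mfderiv I 𝓘(ℝ, E) (extChartAt I p) p).inverse)
    (η.comp (mfderiv I 𝓘(ℝ, E) (extChartAt I p) p).inverse)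

/-- Non-negative contravariant sectional curvature on all planes in the cotangent spaces. -/
def HasNonnegCurvature (P : SharpField I M) (g : MetricField I M) : Prop :=
  ∀ (p : M) (θ η : Covector I p), LinearIndependent ℝ ![θ, η] →
    0 ≤ sectionalCurvature I P g p θ η

/-- Non-positive contravariant sectional curvature on all planes in the cotangent spaces. -/
def HasNonposCurvature (P : SharpField I M) (g : MetricField I M) : Prop :=
  ∀ (p : M) (θ η : Covector I p), LinearIndependent ℝ ![θ, η] →
    sectionalCurvature I P g p θ η ≤ 0

end Manifold

/-! ## Warped products -/

section Warped

variable {E₁ : Type*} [NormedAddCommGroup E₁] [NormedSpace ℝ E₁]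
  {H₁ : Type*} [TopologicalSpace H₁] (I₁ : ModelWithCorners ℝ E₁ H₁)
  {M₁ : Type*} [TopologicalSpace M₁] [ChartedSpace H₁ M₁]
  {E₂ : Type*} [NormedAddCommGroup E₂] [NormedSpace ℝ E₂]
  {H₂ : Type*} [TopologicalSpace H₂] (I₂ : ModelWithCorners ℝ E₂ H₂)
  {M₂ : Type*} [TopologicalSpace M₂] [ChartedSpace H₂ M₂]

/-- The differential of the projection `π₁ : M₁ × M₂ → M₁`. -/
def dfst (x : M₁ × M₂) : TangentSpace (I₁.prod I₂) x →L[ℝ] TangentSpace I₁ x.1 :=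
  mfderiv (I₁.prod I₂) I₁ Prod.fst x

/-- The differential of the projection `π₂ : M₁ × M₂ → M₂`. -/
def dsnd (x : M₁ × M₂) : TangentSpace (I₁.prod I₂) x →L[ℝ] TangentSpace I₂ x.2 :=
  mfderiv (I₁.prod I₂) I₂ Prod.snd x

/-- The horizontal lift `T_{x₁}M₁ → T_{(x₁, x₂)}(M₁ × M₂)`. -/
def hlift (x : M₁ × M₂) : TangentSpace I₁ x.1 →L[ℝ] TangentSpace (I₁.prod I₂) x :=
  ContinuousLinearMap.inl ℝ (TangentSpace I₁ x.1) (TangentSpace I₂ x.2)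

/-- The vertical lift `T_{x₂}M₂ → T_{(x₁, x₂)}(M₁ × M₂)`. -/
def vlift (x : M₁ × M₂) : TangentSpace I₂ x.2 →L[ℝ] TangentSpace (I₁.prod I₂) x :=
  ContinuousLinearMap.inr ℝ (TangentSpace I₁ x.1) (TangentSpace I₂ x.2)

/-- The warped metric `π₁^*(g₁) + (f ∘ π₁)² π₂^*(g₂)`. -/
def warpedMetric (g₁ : MetricField I₁ M₁) (f : M₁ → ℝ) (g₂ : MetricField I₂ M₂) :
    MetricField (I₁.prod I₂) (M₁ × M₂) :=
  fun x => pullbackForm (dfst I₁ I₂ x) (g₁ x.1)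
    + f x.1 ^ 2 • pullbackForm (dsnd I₁ I₂ x) (g₂ x.2)

/-- The warped bivector field `P₁ + ν P₂`, that is `♯(θ) = (♯₁ θ₁)^h + ν (♯₂ θ₂)^v` with `θ₁`, `θ₂`
the restrictions of `θ` to the horizontal and to the vertical vectors. -/
def warpedBivector (P₁ : SharpField I₁ M₁) (ν : M₁ → ℝ) (P₂ : SharpField I₂ M₂) :
    SharpField (I₁.prod I₂) (M₁ × M₂) :=
  fun x => (hlift I₁ I₂ x).comp ((P₁ x.1).comp ((hlift I₁ I₂ x).precomp ℝ))
    + ν x.1 • (vlift I₁ I₂ x).comp ((P₂ x.2).comp ((vlift I₁ I₂ x).precomp ℝ))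

end Warped

end ContravariantGeometry

end

open scoped Manifold ContDiff

noncomputable section

namespace ContravariantGeometry

/-! ### Coordinate calculus for the contravariant Levi-Civita connection. -/

section Local

set_option maxSynthPendingDepth 3

variable {V : Type*} [NormedAddCommGroup V] [NormedSpace ℝ V]

/-! In a chart the contravariant Levi-Civita connection is the derivative along the anchor plus a
Christoffel tensor built from the sharp map, the inverse metric and their first derivatives
(`koszul_eq`, `leviCivita_eq`). The inverse metric is differentiated only in directions tangent to
the image of the sharp map. For the warped product its second block carries the factor `φ⁻¹`, where
`φ = f²`, and the Casimir condition says exactly that `φ` has zero derivative in these directions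
(`fderiv_inverseMetric_sharp`). Since `c` is constant too, the connection and the curvature split
with no mixed terms: the second-factor curvature is multiplied by `c²`, and raising an index
contributes `φ⁻¹`. So the numerators `N(a, b) = g̃(R(a, b)b, a)` satisfy `N = N₁ + f⁻² c² N₂`,
evaluated on the restrictions of the covectors to the two factors (`curvatureNumerator_warped`).

Independent covectors on the product may restrict to dependent ones on a factor. The sign conditions
are therefore restated for `N` on all pairs (`hasNonnegCurvature_iff`, `hasNonposCurvature_iff`):
the Gram determinant is positive on independent pairs (`gram_pos`) and `N` vanishes on dependent
pairs (`cometric_curvature_eq_zero`). Because `f⁻² c² > 0`, signs on the factors give the sign on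
the product; conversely, covectors pulled back from one factor isolate its term. -/

/-- A skew field `P` and a metric `g` which are smooth on the open set `U`. -/
structure IsLocalPair (P : V → (V →L[ℝ] ℝ) →L[ℝ] V) (g : V → V →L[ℝ] V →L[ℝ] ℝ)
    (U : Set V) : Prop where
  isOpen : IsOpen U
  smooth_sharp : ContDiffOn ℝ ∞ P U
  smooth_metric : ContDiffOn ℝ ∞ g U
  skew : ∀ z ∈ U, ∀ θ η : V →L[ℝ] ℝ, η (P z θ) = -θ (P z η)
  symm : ∀ z ∈ U, ∀ v w : V, g z v w = g z w v
  pos : ∀ z ∈ U, ∀ v : V, v ≠ 0 → 0 < g z v v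

/-- The field of inverse metrics `♯ : V* → V`. -/
def inverseMetric (g : V → V →L[ℝ] V →L[ℝ] ℝ) (z : V) : (V →L[ℝ] ℝ) →L[ℝ] V := (g z).inverse

/-- The part of the Koszul expression without derivatives of the one-forms. -/
def christoffelForm (P : V → (V →L[ℝ] ℝ) →L[ℝ] V) (g : V → V →L[ℝ] V →L[ℝ] ℝ) (z : V)
    (a b c : V →L[ℝ] ℝ) : ℝ :=
  b (fderiv ℝ (inverseMetric g) z (P z a) c) + a (fderiv ℝ (inverseMetric g) z (P z b) c)
    - a (fderiv ℝ (inverseMetric g) z (P z c) b) + b (fderiv ℝ P z (inverseMetric g z c) a)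
    + a (fderiv ℝ P z (inverseMetric g z b) c) + b (fderiv ℝ P z (inverseMetric g z a) c)

/-- The bracket of constant one-forms. -/
def constBracket (P : V → (V →L[ℝ] ℝ) →L[ℝ] V) (z : V) (a b : V →L[ℝ] ℝ) : V →L[ℝ] ℝ :=
  b.comp ((fderiv ℝ P z).flip a)

@[simp]
theorem constBracket_apply (P : V → (V →L[ℝ] ℝ) →L[ℝ] V) (z : V) (a b : V →L[ℝ] ℝ) (v : V) :
    constBracket P z a b v = b (fderiv ℝ P z v a) := rfl

variable {P : V → (V →L[ℝ] ℝ) →L[ℝ] V} {g : V → V →L[ℝ] V →L[ℝ] ℝ} {U : Set V} {z : V}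

theorem christoffelForm_add (a b c c' : V →L[ℝ] ℝ) :
    christoffelForm P g z a b (c + c') =
      christoffelForm P g z a b c + christoffelForm P g z a b c' := by
  simp only [christoffelForm, map_add, add_apply]; ring

theorem christoffelForm_smul (a b c : V →L[ℝ] ℝ) (r : ℝ) :
    christoffelForm P g z a b (r • c) = r * christoffelForm P g z a b c := by
  simp only [christoffelForm, map_smul, smul_apply, smul_eq_mul]; ring

theorem christoffelForm_smul_left (a b c : V →L[ℝ] ℝ) (r : ℝ) :
    christoffelForm P g z (r • a) b c = r * christoffelForm P g z a b c := by
  simp only [christoffelForm, map_smul, smul_apply, smul_eq_mul]; ring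

theorem christoffelForm_smul_right (a b c : V →L[ℝ] ℝ) (r : ℝ) :
    christoffelForm P g z a (r • b) c = r * christoffelForm P g z a b c := by
  simp only [christoffelForm, map_smul, smul_apply, smul_eq_mul]; ring

namespace IsLocalPair

theorem differentiableAt_sharp (h : IsLocalPair P g U) (hz : z ∈ U) : DifferentiableAt ℝ P z :=
  (h.smooth_sharp.contDiffAt (h.isOpen.mem_nhds hz)).differentiableAt (by simp)

theorem differentiableAt_metric (h : IsLocalPair P g U) (hz : z ∈ U) : DifferentiableAt ℝ g z :=
  (h.smooth_metric.contDiffAt (h.isOpen.mem_nhds hz)).differentiableAt (by simp)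

theorem differentiableAt_fderiv_sharp (h : IsLocalPair P g U) (hz : z ∈ U) :
    DifferentiableAt ℝ (fderiv ℝ P) z :=
  ((h.smooth_sharp.contDiffAt (h.isOpen.mem_nhds hz)).fderiv_right (m := ∞)
    le_rfl).differentiableAt (by simp)

/-- Differentiate the skewness identity, which holds on a whole neighbourhood since `U` is open. -/
theorem skew_fderiv (h : IsLocalPair P g U) (hz : z ∈ U) (v : V) (θ η : V →L[ℝ] ℝ) :
    η (fderiv ℝ P z v θ) = -θ (fderiv ℝ P z v η) := by
  have hP := (h.differentiableAt_sharp hz).hasFDerivAt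
  have h1 : ∀ a b : V →L[ℝ] ℝ,
      HasFDerivAt (fun y => b (P y a)) (b.comp ((fderiv ℝ P z).flip a)) z := fun a b => by
    have := b.hasFDerivAt.comp z (hP.clm_apply (hasFDerivAt_const a z))
    simp only [ContinuousLinearMap.comp_zero, zero_add] at this
    exact this
  have h2 : (fun y => η (P y θ)) =ᶠ[nhds z] fun y => -θ (P y η) := by
    filter_upwards [h.isOpen.mem_nhds hz] with y hy using h.skew y hy θ η
  have h3 := ((h1 η θ).neg.congr_of_eventuallyEq h2).unique (h1 θ η)
  have := DFunLike.congr_fun h3 v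
  simpa using this.symm

theorem cometric_comm (h : IsLocalPair P g U) (hz : z ∈ U) (θ η : V →L[ℝ] ℝ) :
    cometric (g z) θ η = cometric (g z) η θ := h.symm z hz _ _

theorem differentiableAt_constBracket (h : IsLocalPair P g U) (hz : z ∈ U) (a b : V →L[ℝ] ℝ) :
    DifferentiableAt ℝ (fun y => constBracket P y a b) z := by
  have h3 := h.differentiableAt_fderiv_sharp hz
  have h1 : DifferentiableAt ℝ (fun y => (fderiv ℝ P y).flip a) z :=
    ((ContinuousLinearMap.flipₗᵢ ℝ V (V →L[ℝ] ℝ) V).differentiable.differentiableAt.comp z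
      h3).clm_apply (differentiableAt_const a)
  exact (differentiableAt_const b).clm_comp h1

variable {α β γ : V → V →L[ℝ] ℝ}

/-- After expanding by the product rule, skewness of `P` and of its derivative cancels the surplus
terms, leaving each form differentiated only along the anchor of the other. -/
theorem formBracket_apply (h : IsLocalPair P g U) (hz : z ∈ U) (hα : DifferentiableAt ℝ α z)
    (hβ : DifferentiableAt ℝ β z) (v : V) :
    formBracket P α β z v = fderiv ℝ β z (P z (α z)) v - fderiv ℝ α z (P z (β z)) v
      + β z (fderiv ℝ P z v (α z)) := by
  have hP := h.differentiableAt_sharp hz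
  have h1 : ∀ {δ : V → V →L[ℝ] ℝ}, DifferentiableAt ℝ δ z →
      fderiv ℝ (anchor P δ) z v = fderiv ℝ P z v (δ z) + P z (fderiv ℝ δ z v) := fun hω => by
    unfold anchor
    rw [fderiv_clm_apply hP hω]
    simp [add_comm]
  have h2 : fderiv ℝ (bivectorPairing P α β) z v =
      fderiv ℝ β z v (P z (α z)) + β z (fderiv ℝ (anchor P α) z v) := by
    unfold bivectorPairing
    rw [fderiv_clm_apply hβ (by unfold anchor; fun_prop)]
    simp [anchor, add_comm]
  simp only [formBracket, lieDerivForm, sub_apply, add_apply, ContinuousLinearMap.comp_apply, h2,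
    h1 hα, h1 hβ, map_add, anchor]
  linear_combination -h.skew_fderiv hz v (β z) (α z) - h.skew z hz (α z) (fderiv ℝ β z v)

theorem formBracket_const (h : IsLocalPair P g U) (hz : z ∈ U) (a b : V →L[ℝ] ℝ) :
    formBracket P (fun _ => a) (fun _ => b) z = constBracket P z a b := by
  ext v
  rw [h.formBracket_apply hz (differentiableAt_const a) (differentiableAt_const b)]
  simp

variable [FiniteDimensional ℝ V]

/-- Positive definiteness gives injectivity, and `V` and its dual have equal dimension. -/
theorem isInvertible (h : IsLocalPair P g U) (hz : z ∈ U) : (g z).IsInvertible := by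
  have hinj : Function.Injective (g z) := by
    rw [injective_iff_map_eq_zero]
    intro v hv
    by_contra hne
    have := h.pos z hz v hne
    simp [hv] at this
  let L : V →ₗ[ℝ] (V →L[ℝ] ℝ) := (g z : V →ₗ[ℝ] (V →L[ℝ] ℝ))
  have hdim : Module.finrank ℝ V = Module.finrank ℝ (V →L[ℝ] ℝ) := by
    rw [← (LinearMap.toContinuousLinearMap (𝕜 := ℝ) (E := V) (F' := ℝ)).finrank_eq]
    exact (Subspace.dual_finrank_eq (K := ℝ) (V := V)).symm
  refine ⟨(LinearEquiv.ofInjectiveOfFinrankEq L hinj hdim).toContinuousLinearEquiv, ?_⟩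
  ext v w
  rfl

theorem metric_inverseMetric (h : IsLocalPair P g U) (hz : z ∈ U) (θ : V →L[ℝ] ℝ) :
    g z (inverseMetric g z θ) = θ :=
  (h.isInvertible hz).self_apply_inverse θ

theorem inverseMetric_metric (h : IsLocalPair P g U) (hz : z ∈ U) (v : V) :
    inverseMetric g z (g z v) = v :=
  (h.isInvertible hz).inverse_apply_self v

theorem cometric_eq (h : IsLocalPair P g U) (hz : z ∈ U) (θ η : V →L[ℝ] ℝ) :
    cometric (g z) θ η = θ (inverseMetric g z η) := by
  change g z (inverseMetric g z θ) _ = _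
  rw [h.metric_inverseMetric hz]; rfl

theorem inverseMetric_symm (h : IsLocalPair P g U) (hz : z ∈ U) (θ η : V →L[ℝ] ℝ) :
    θ (inverseMetric g z η) = η (inverseMetric g z θ) := by
  rw [← h.cometric_eq hz, ← h.cometric_eq hz, h.cometric_comm hz]

theorem contDiffAt_inverseMetric (h : IsLocalPair P g U) (hz : z ∈ U) :
    ContDiffAt ℝ ∞ (inverseMetric g) z := by
  obtain ⟨e, he⟩ := h.isInvertible hz
  have h1 : ContDiffAt ℝ ∞ ContinuousLinearMap.inverse (g z) := he ▸ contDiffAt_map_inverse e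
  exact h1.comp z (h.smooth_metric.contDiffAt (h.isOpen.mem_nhds hz))

theorem differentiableAt_inverseMetric (h : IsLocalPair P g U) (hz : z ∈ U) :
    DifferentiableAt ℝ (inverseMetric g) z :=
  (h.contDiffAt_inverseMetric hz).differentiableAt (by simp)

theorem differentiableAt_fderiv_inverseMetric (h : IsLocalPair P g U) (hz : z ∈ U) :
    DifferentiableAt ℝ (fderiv ℝ (inverseMetric g)) z :=
  ((h.contDiffAt_inverseMetric hz).fderiv_right (m := ∞)
    le_rfl).differentiableAt (by simp)

theorem fderiv_cometricPairing (h : IsLocalPair P g U) (hz : z ∈ U) (hα : DifferentiableAt ℝ α z)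
    (hβ : DifferentiableAt ℝ β z) (v : V) :
    fderiv ℝ (cometricPairing g α β) z v = fderiv ℝ α z v (inverseMetric g z (β z))
      + α z (fderiv ℝ (inverseMetric g) z v (β z)) + fderiv ℝ β z v (inverseMetric g z (α z)) := by
  have hG := h.differentiableAt_inverseMetric hz
  have h1 : cometricPairing g α β =ᶠ[nhds z] fun y => α y (inverseMetric g y (β y)) := by
    filter_upwards [h.isOpen.mem_nhds hz] with y hy using h.cometric_eq hy _ _
  rw [h1.fderiv_eq, fderiv_clm_apply hα (by fun_prop), fderiv_clm_apply hG hβ]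
  simp [h.inverseMetric_symm hz (α z)]
  ring

/-- All derivatives of `α` and `γ` cancel between the cometric terms and the bracket terms, and so
do those of `β` along `♯γ`; the derivative of `β` along `♯α` occurs twice. The remainder is
tensorial. -/
theorem koszul_eq (h : IsLocalPair P g U) (hz : z ∈ U) (hα : DifferentiableAt ℝ α z)
    (hβ : DifferentiableAt ℝ β z) (hγ : DifferentiableAt ℝ γ z) :
    koszul P g α β γ z = 2 * fderiv ℝ β z (P z (α z)) (inverseMetric g z (γ z))
      + christoffelForm P g z (α z) (β z) (γ z) := by
  simp only [koszul, h.fderiv_cometricPairing hz hα hβ, h.fderiv_cometricPairing hz hα hγ,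
    h.fderiv_cometricPairing hz hβ hγ]
  simp only [cometricPairing, h.cometric_eq hz, h.formBracket_apply hz hα hβ,
    h.formBracket_apply hz hγ hα, h.formBracket_apply hz hγ hβ, anchor, christoffelForm]
  ring

end IsLocalPair

/-! ### The Christoffel tensor and the curvature on constant covectors. -/

variable [FiniteDimensional ℝ V]

/-- The Christoffel tensor of the contravariant Levi-Civita connection. -/
def christoffel (P : V → (V →L[ℝ] ℝ) →L[ℝ] V) (g : V → V →L[ℝ] V →L[ℝ] ℝ) (z : V)
    (a b : V →L[ℝ] ℝ) : V →L[ℝ] ℝ :=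
  ∑ i, ((1 / 2 : ℝ) * christoffelForm P g z a b (g z (Module.finBasis ℝ V i))) •
    ((Module.finBasis ℝ V).coord i).toContinuousLinearMap

theorem eq_sum_coord_smul (L : V →L[ℝ] ℝ) :
    ∑ i, L (Module.finBasis ℝ V i) • ((Module.finBasis ℝ V).coord i).toContinuousLinearMap = L := by
  ext v
  conv_rhs => rw [← (Module.finBasis ℝ V).sum_repr v]
  simp only [sum_apply, smul_apply, map_sum, map_smul, smul_eq_mul]
  exact Finset.sum_congr rfl fun i _ => mul_comm _ _

/-- Linearity of the Koszul remainder in its last slot makes the basis expansion independent of the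
basis, so later computations need no coordinates. -/
theorem christoffel_apply (a b : V →L[ℝ] ℝ) (v : V) :
    christoffel P g z a b v = (1 / 2 : ℝ) * christoffelForm P g z a b (g z v) := by
  let L : V →ₗ[ℝ] ℝ :=
    { toFun := fun w => (1 / 2 : ℝ) * christoffelForm P g z a b (g z w)
      map_add' := fun x y => by rw [map_add, christoffelForm_add]; ring
      map_smul' := fun r x => by
        rw [map_smul, christoffelForm_smul, smul_eq_mul, RingHom.id_apply]; ring }
  exact DFunLike.congr_fun (eq_sum_coord_smul L.toContinuousLinearMap) v

theorem christoffel_smul_left (a b : V →L[ℝ] ℝ) (r : ℝ) :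
    christoffel P g z (r • a) b = r • christoffel P g z a b := by
  ext v; simp only [christoffel_apply, christoffelForm_smul_left, smul_apply, smul_eq_mul]; ring

theorem christoffel_smul_right (a b : V →L[ℝ] ℝ) (r : ℝ) :
    christoffel P g z a (r • b) = r • christoffel P g z a b := by
  ext v; simp only [christoffel_apply, christoffelForm_smul_right, smul_apply, smul_eq_mul]; ring

theorem christoffel_zero_left (b : V →L[ℝ] ℝ) : christoffel P g z 0 b = 0 := by
  simpa using christoffel_smul_left (P := P) (g := g) (z := z) 0 b 0

theorem christoffel_zero_right (a : V →L[ℝ] ℝ) : christoffel P g z a 0 = 0 := by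
  simpa using christoffel_smul_right (P := P) (g := g) (z := z) a 0 0

namespace IsLocalPair

variable {α β γ : V → V →L[ℝ] ℝ}

theorem differentiableAt_christoffel (h : IsLocalPair P g U) (hz : z ∈ U) (a b : V →L[ℝ] ℝ) :
    DifferentiableAt ℝ (fun y => christoffel P g y a b) z := by
  have h1 := h.differentiableAt_sharp hz
  have h2 := h.differentiableAt_metric hz
  have h3 := h.differentiableAt_fderiv_sharp hz
  have h4 := h.differentiableAt_inverseMetric hz
  have h5 := h.differentiableAt_fderiv_inverseMetric hz
  unfold christoffel christoffelForm
  fun_prop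

theorem leviCivita_eq (h : IsLocalPair P g U) (hz : z ∈ U) (hα : DifferentiableAt ℝ α z)
    (hβ : DifferentiableAt ℝ β z) :
    leviCivita P g α β z = fderiv ℝ β z (P z (α z)) + christoffel P g z (α z) (β z) := by
  have h2 := h.differentiableAt_metric hz
  rw [← eq_sum_coord_smul (fderiv ℝ β z (P z (α z)))]
  unfold leviCivita christoffel
  rw [← Finset.sum_add_distrib]
  refine Finset.sum_congr rfl fun i _ => ?_
  rw [h.koszul_eq hz hα hβ (by fun_prop), h.inverseMetric_metric hz, ← add_smul]
  congr 1
  ring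

theorem leviCivita_const (h : IsLocalPair P g U) (hz : z ∈ U) (a b : V →L[ℝ] ℝ) :
    leviCivita P g (fun _ => a) (fun _ => b) z = christoffel P g z a b := by
  rw [h.leviCivita_eq hz (differentiableAt_const a) (differentiableAt_const b)]
  simp

/-- On constant forms the inner connection terms are Christoffel terms, so only these get
differentiated; the bracket term acts on a constant form and contributes no derivative. -/
theorem curvature_const (h : IsLocalPair P g U) (hz : z ∈ U) (a b c : V →L[ℝ] ℝ) :
    curvature P g (fun _ => a) (fun _ => b) (fun _ => c) z =
      (fderiv ℝ (fun y => christoffel P g y b c) z (P z a)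
        + christoffel P g z a (christoffel P g z b c))
      - (fderiv ℝ (fun y => christoffel P g y a c) z (P z b)
        + christoffel P g z b (christoffel P g z a c))
      - christoffel P g z (constBracket P z a b) c := by
  have hU := h.isOpen.mem_nhds hz
  have h1 : ∀ a b : V →L[ℝ] ℝ, leviCivita P g (fun _ => a) (fun _ => b) =ᶠ[nhds z]
      fun y => christoffel P g y a b := fun a b => by
    filter_upwards [hU] with y hy using h.leviCivita_const hy a b
  have h2 : formBracket P (fun _ => a) (fun _ => b) =ᶠ[nhds z] fun y => constBracket P y a b := by
    filter_upwards [hU] with y hy using h.formBracket_const hy a b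
  have h3 : ∀ a b c : V →L[ℝ] ℝ,
      leviCivita P g (fun _ => a) (leviCivita P g (fun _ => b) (fun _ => c)) z =
        fderiv ℝ (fun y => christoffel P g y b c) z (P z a)
          + christoffel P g z a (christoffel P g z b c) := fun a b c => by
    rw [h.leviCivita_eq hz (differentiableAt_const a)
      ((h1 b c).differentiableAt_iff.2 (h.differentiableAt_christoffel hz b c)),
      (h1 b c).fderiv_eq, (h1 b c).eq_of_nhds]
  unfold curvature
  rw [h3, h3, h.leviCivita_eq hz
    (h2.differentiableAt_iff.2 (h.differentiableAt_constBracket hz a b))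
    (differentiableAt_const c), h2.eq_of_nhds]
  simp

/-! ### Dependent covectors and positivity of the Gram determinant. -/

theorem curvature_const_zero (h : IsLocalPair P g U) (hz : z ∈ U) (a : V →L[ℝ] ℝ) :
    curvature P g (fun _ => a) (fun _ => 0) (fun _ => 0) z = 0 := by
  rw [h.curvature_const hz]
  simp [christoffel_zero_right]

/-- The bracket of `r • b` with `b` vanishes by skewness, and the two second-order terms agree by
homogeneity. -/
theorem curvature_const_smul (h : IsLocalPair P g U) (hz : z ∈ U) (b : V →L[ℝ] ℝ) (r : ℝ) :
    curvature P g (fun _ => r • b) (fun _ => b) (fun _ => b) z = 0 := by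
  have h0 : constBracket P z (r • b) b = 0 := by
    ext v
    have := h.skew_fderiv hz v b b
    have h1 : b (fderiv ℝ P z v b) = 0 := by linarith
    simp [h1]
  rw [h.curvature_const hz, h0, christoffel_zero_left]
  simp only [christoffel_smul_left, christoffel_smul_right]
  rw [fderiv_fun_const_smul (h.differentiableAt_christoffel hz b b)]
  simp

/-- The numerator `g̃(R(ξ, ζ)ζ, ξ)` of the sectional curvature vanishes on dependent covectors. -/
theorem cometric_curvature_eq_zero (h : IsLocalPair P g U) (hz : z ∈ U) {a b : V →L[ℝ] ℝ}
    (hab : ¬ LinearIndependent ℝ ![a, b]) :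
    cometric (g z) (curvature P g (fun _ => a) (fun _ => b) (fun _ => b) z) a = 0 := by
  suffices hR : curvature P g (fun _ => a) (fun _ => b) (fun _ => b) z = 0 by
    rw [hR, h.cometric_eq hz]; rfl
  by_cases hb : b = 0
  · subst hb; exact h.curvature_const_zero hz a
  · have h1 : ¬ LinearIndependent ℝ ![b, a] := fun h' => hab (LinearIndependent.pair_symm_iff.1 h')
    rw [LinearIndependent.pair_iff' hb] at h1
    push Not at h1
    obtain ⟨r, rfl⟩ := h1
    exact h.curvature_const_smul hz b r

theorem cometric_self_pos (h : IsLocalPair P g U) (hz : z ∈ U) {a : V →L[ℝ] ℝ} (ha : a ≠ 0) :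
    0 < cometric (g z) a a := by
  refine h.pos z hz _ fun h0 => ha ?_
  rw [← h.metric_inverseMetric hz a]
  change g z ((g z).inverse a) = 0
  rw [h0, map_zero]

theorem gram_pos (h : IsLocalPair P g U) (hz : z ∈ U) {a b : V →L[ℝ] ℝ}
    (hab : LinearIndependent ℝ ![a, b]) :
    0 < cometric (g z) a a * cometric (g z) b b - cometric (g z) a b ^ 2 := by
  have ha : a ≠ 0 := hab.ne_zero 0
  have hA := h.cometric_self_pos hz ha
  set A := cometric (g z) a a with hAdef
  set B := cometric (g z) a b with hBdef
  -- Strict Cauchy–Schwarz: up to the factor `A` this is the component of `b` orthogonal to `a`, and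
  -- its squared norm is `A` times the Gram determinant.
  have hc : A • b - B • a ≠ 0 := fun h0 => by
    have := (LinearIndependent.pair_iff.1 hab) (-B) A (by rw [← h0]; module)
    exact hA.ne' this.2
  have h1 := h.cometric_self_pos hz hc
  have h2 : cometric (g z) (A • b - B • a) (A • b - B • a) =
      A * (A * cometric (g z) b b - B ^ 2) := by
    have hba : cometric (g z) b a = B := h.cometric_comm hz b a
    simp only [h.cometric_eq hz, map_sub, map_smul, sub_apply, smul_apply, smul_eq_mul]
      at hAdef hBdef hba ⊢
    rw [hba, ← hAdef, ← hBdef]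
    ring
  rw [h2] at h1
  exact (mul_pos_iff_of_pos_left hA).1 h1

end IsLocalPair

end Local

/-! ### Splitting of connection and curvature for a local warped product. -/

section LocalWarped

set_option maxSynthPendingDepth 3

variable {V₁ : Type*} [NormedAddCommGroup V₁] [NormedSpace ℝ V₁]
  {V₂ : Type*} [NormedAddCommGroup V₂] [NormedSpace ℝ V₂]

/-- The restriction of a covector to the first factor. -/
abbrev covFst (a : V₁ × V₂ →L[ℝ] ℝ) : V₁ →L[ℝ] ℝ := a.comp (ContinuousLinearMap.inl ℝ V₁ V₂)

/-- The restriction of a covector to the second factor. -/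
abbrev covSnd (a : V₁ × V₂ →L[ℝ] ℝ) : V₂ →L[ℝ] ℝ := a.comp (ContinuousLinearMap.inr ℝ V₁ V₂)

theorem apply_eq_covFst_add_covSnd (a : V₁ × V₂ →L[ℝ] ℝ) (v : V₁ × V₂) :
    a v = covFst a v.1 + covSnd a v.2 := by
  simp [← map_add]

/-- On `U₁ × U₂`, the pair `(P, g)` is the warped product of `(P₁, g₁)` and `(P₂, g₂)` with
`P = P₁ + c P₂` and `g = g₁ + φ g₂`, for a positive Casimir function `φ` of `P₁`. -/
structure IsLocalWarped (P : V₁ × V₂ → (V₁ × V₂ →L[ℝ] ℝ) →L[ℝ] V₁ × V₂)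
    (g : V₁ × V₂ → V₁ × V₂ →L[ℝ] V₁ × V₂ →L[ℝ] ℝ)
    (P₁ : V₁ → (V₁ →L[ℝ] ℝ) →L[ℝ] V₁) (g₁ : V₁ → V₁ →L[ℝ] V₁ →L[ℝ] ℝ) (U₁ : Set V₁)
    (P₂ : V₂ → (V₂ →L[ℝ] ℝ) →L[ℝ] V₂) (g₂ : V₂ → V₂ →L[ℝ] V₂ →L[ℝ] ℝ) (U₂ : Set V₂)
    (φ : V₁ → ℝ) (c : ℝ) : Prop where
  left : IsLocalPair P₁ g₁ U₁
  right : IsLocalPair P₂ g₂ U₂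
  smooth : ContDiffOn ℝ ∞ φ U₁
  pos : ∀ y ∈ U₁, 0 < φ y
  casimir : ∀ y ∈ U₁, ∀ a : V₁ →L[ℝ] ℝ, fderiv ℝ φ y (P₁ y a) = 0
  sharp_apply : ∀ z ∈ U₁ ×ˢ U₂, ∀ a : V₁ × V₂ →L[ℝ] ℝ,
    P z a = (P₁ z.1 (covFst a), c • P₂ z.2 (covSnd a))
  metric_apply : ∀ z ∈ U₁ ×ˢ U₂, ∀ v w : V₁ × V₂,
    g z v w = g₁ z.1 v.1 w.1 + φ z.1 * g₂ z.2 v.2 w.2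

namespace IsLocalWarped

variable {P : V₁ × V₂ → (V₁ × V₂ →L[ℝ] ℝ) →L[ℝ] V₁ × V₂}
  {g : V₁ × V₂ → V₁ × V₂ →L[ℝ] V₁ × V₂ →L[ℝ] ℝ}
  {P₁ : V₁ → (V₁ →L[ℝ] ℝ) →L[ℝ] V₁} {g₁ : V₁ → V₁ →L[ℝ] V₁ →L[ℝ] ℝ} {U₁ : Set V₁}
  {P₂ : V₂ → (V₂ →L[ℝ] ℝ) →L[ℝ] V₂} {g₂ : V₂ → V₂ →L[ℝ] V₂ →L[ℝ] ℝ} {U₂ : Set V₂}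
  {φ : V₁ → ℝ} {c : ℝ} {z : V₁ × V₂}

theorem isLocalPair (h : IsLocalWarped P g P₁ g₁ U₁ P₂ g₂ U₂ φ c) :
    IsLocalPair P g (U₁ ×ˢ U₂) where
  isOpen := h.left.isOpen.prod h.right.isOpen
  smooth_sharp := by
    have e1 : ContDiffOn ℝ ∞ (fun z : V₁ × V₂ => P₁ z.1) (U₁ ×ˢ U₂) :=
      h.left.smooth_sharp.comp contDiff_fst.contDiffOn fun z hz => hz.1
    have e2 : ContDiffOn ℝ ∞ (fun z : V₁ × V₂ => P₂ z.2) (U₁ ×ˢ U₂) :=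
      h.right.smooth_sharp.comp contDiff_snd.contDiffOn fun z hz => hz.2
    have e : ContDiffOn ℝ ∞ (fun z : V₁ × V₂ =>
        (ContinuousLinearMap.inl ℝ V₁ V₂).comp
            ((P₁ z.1).comp ((ContinuousLinearMap.inl ℝ V₁ V₂).precomp ℝ))
          + c • (ContinuousLinearMap.inr ℝ V₁ V₂).comp
            ((P₂ z.2).comp ((ContinuousLinearMap.inr ℝ V₁ V₂).precomp ℝ))) (U₁ ×ˢ U₂) :=
      (contDiffOn_const.clm_comp (e1.clm_comp contDiffOn_const)).add
        ((contDiffOn_const.clm_comp (e2.clm_comp contDiffOn_const)).const_smul c)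
    refine e.congr fun z hz => ContinuousLinearMap.ext fun a => ?_
    rw [h.sharp_apply z hz]
    simp
  smooth_metric := by
    have e1 : ContDiffOn ℝ ∞ (fun z : V₁ × V₂ => g₁ z.1) (U₁ ×ˢ U₂) :=
      h.left.smooth_metric.comp contDiff_fst.contDiffOn fun z hz => hz.1
    have e2 : ContDiffOn ℝ ∞ (fun z : V₁ × V₂ => g₂ z.2) (U₁ ×ˢ U₂) :=
      h.right.smooth_metric.comp contDiff_snd.contDiffOn fun z hz => hz.2
    have e3 : ContDiffOn ℝ ∞ (fun z : V₁ × V₂ => φ z.1) (U₁ ×ˢ U₂) :=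
      h.smooth.comp contDiff_fst.contDiffOn fun z hz => hz.1
    have e : ContDiffOn ℝ ∞ (fun z : V₁ × V₂ =>
        pullbackForm (ContinuousLinearMap.fst ℝ V₁ V₂) (g₁ z.1)
          + φ z.1 • pullbackForm (ContinuousLinearMap.snd ℝ V₁ V₂) (g₂ z.2)) (U₁ ×ˢ U₂) :=
      (contDiffOn_const.clm_comp (e1.clm_comp contDiffOn_const)).add
        (e3.smul (contDiffOn_const.clm_comp (e2.clm_comp contDiffOn_const)))
    refine e.congr fun z hz => ContinuousLinearMap.ext fun v => ContinuousLinearMap.ext fun w => ?_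
    rw [h.metric_apply z hz]
    rfl
  skew z hz θ η := by
    rw [h.sharp_apply z hz, h.sharp_apply z hz, apply_eq_covFst_add_covSnd η,
      apply_eq_covFst_add_covSnd θ]
    simp only [map_smul, smul_eq_mul]
    rw [h.left.skew _ hz.1, h.right.skew _ hz.2]
    ring
  symm z hz v w := by
    rw [h.metric_apply z hz, h.metric_apply z hz, h.left.symm _ hz.1, h.right.symm _ hz.2]
  pos z hz v hv := by
    rw [h.metric_apply z hz]
    have hφ := h.pos _ hz.1
    have n1 : 0 ≤ g₁ z.1 v.1 v.1 := by
      by_cases h1 : v.1 = 0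
      · simp [h1]
      · exact (h.left.pos _ hz.1 _ h1).le
    have n2 : 0 ≤ g₂ z.2 v.2 v.2 := by
      by_cases h2 : v.2 = 0
      · simp [h2]
      · exact (h.right.pos _ hz.2 _ h2).le
    by_cases h1 : v.1 = 0
    · have h2 : v.2 ≠ 0 := fun h2 => hv (Prod.ext h1 h2)
      have := mul_pos hφ (h.right.pos _ hz.2 _ h2)
      linarith
    · have := h.left.pos _ hz.1 _ h1
      have := mul_nonneg hφ.le n2
      linarith

theorem fderiv_sharp (h : IsLocalWarped P g P₁ g₁ U₁ P₂ g₂ U₂ φ c) (hz : z ∈ U₁ ×ˢ U₂)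
    (v : V₁ × V₂) (a : V₁ × V₂ →L[ℝ] ℝ) :
    fderiv ℝ P z v a =
      (fderiv ℝ P₁ z.1 v.1 (covFst a), c • fderiv ℝ P₂ z.2 v.2 (covSnd a)) := by
  have hl := h.isLocalPair
  have h0 := (hl.differentiableAt_sharp hz).hasFDerivAt.clm_apply (hasFDerivAt_const a z)
  have h1 : HasFDerivAt (fun y : V₁ × V₂ => P₁ y.1)
      ((fderiv ℝ P₁ z.1).comp (ContinuousLinearMap.fst ℝ V₁ V₂)) z :=
    (h.left.differentiableAt_sharp hz.1).hasFDerivAt.comp z hasFDerivAt_fst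
  have h2 : HasFDerivAt (fun y : V₁ × V₂ => P₂ y.2)
      ((fderiv ℝ P₂ z.2).comp (ContinuousLinearMap.snd ℝ V₁ V₂)) z :=
    (h.right.differentiableAt_sharp hz.2).hasFDerivAt.comp z hasFDerivAt_snd
  have h3 := (h1.clm_apply (hasFDerivAt_const (covFst a) z)).prodMk
    ((h2.clm_apply (hasFDerivAt_const (covSnd a) z)).const_smul c)
  have h4 := h3.congr_of_eventuallyEq (f₁ := fun y => P y a) (by
    filter_upwards [hl.isOpen.mem_nhds hz] with y hy using h.sharp_apply y hy a)
  have := DFunLike.congr_fun (h0.unique h4) v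
  simpa using this

theorem constBracket_eq (h : IsLocalWarped P g P₁ g₁ U₁ P₂ g₂ U₂ φ c) (hz : z ∈ U₁ ×ˢ U₂)
    (a b : V₁ × V₂ →L[ℝ] ℝ) :
    constBracket P z a b =
      (constBracket P₁ z.1 (covFst a) (covFst b)).comp (ContinuousLinearMap.fst ℝ V₁ V₂)
        + c • (constBracket P₂ z.2 (covSnd a) (covSnd b)).comp
          (ContinuousLinearMap.snd ℝ V₁ V₂) := by
  refine ContinuousLinearMap.ext fun v => ?_
  rw [constBracket_apply, h.fderiv_sharp hz, apply_eq_covFst_add_covSnd b]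
  simp only [map_smul, smul_eq_mul, add_apply, smul_apply, ContinuousLinearMap.comp_apply,
    constBracket_apply, ContinuousLinearMap.coe_fst', ContinuousLinearMap.coe_snd']

theorem covFst_comp_fst_add (a : V₁ →L[ℝ] ℝ) (b : V₂ →L[ℝ] ℝ) :
    covFst (a.comp (ContinuousLinearMap.fst ℝ V₁ V₂) + b.comp (ContinuousLinearMap.snd ℝ V₁ V₂))
      = a := by
  ext; simp

theorem covSnd_comp_fst_add (a : V₁ →L[ℝ] ℝ) (b : V₂ →L[ℝ] ℝ) :
    covSnd (a.comp (ContinuousLinearMap.fst ℝ V₁ V₂) + b.comp (ContinuousLinearMap.snd ℝ V₁ V₂))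
      = b := by
  ext; simp

variable [FiniteDimensional ℝ V₁] [FiniteDimensional ℝ V₂]

/-- The block-diagonal metric sends the proposed vector back to `a`, and inverse images are unique.
-/
theorem inverseMetric_apply (h : IsLocalWarped P g P₁ g₁ U₁ P₂ g₂ U₂ φ c) (hz : z ∈ U₁ ×ˢ U₂)
    (a : V₁ × V₂ →L[ℝ] ℝ) :
    inverseMetric g z a =
      (inverseMetric g₁ z.1 (covFst a), (φ z.1)⁻¹ • inverseMetric g₂ z.2 (covSnd a)) := by
  have hφ := (h.pos _ hz.1).ne'
  rw [← h.isLocalPair.inverseMetric_metric hz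
    (inverseMetric g₁ z.1 (covFst a), (φ z.1)⁻¹ • inverseMetric g₂ z.2 (covSnd a))]
  congr 1
  ext w
  · rw [ContinuousLinearMap.comp_apply, ContinuousLinearMap.comp_apply, h.metric_apply z hz]
    simp [h.left.metric_inverseMetric hz.1]
  · rw [ContinuousLinearMap.comp_apply, ContinuousLinearMap.comp_apply, h.metric_apply z hz]
    simp [h.right.metric_inverseMetric hz.2, hφ]

/-- This is where the Casimir condition acts: the product rule yields a term in the derivative of
`φ⁻¹`, which vanishes along `P z d`. In other directions the splitting would fail in general. -/
theorem fderiv_inverseMetric_sharp (h : IsLocalWarped P g P₁ g₁ U₁ P₂ g₂ U₂ φ c)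
    (hz : z ∈ U₁ ×ˢ U₂) (d a : V₁ × V₂ →L[ℝ] ℝ) :
    fderiv ℝ (inverseMetric g) z (P z d) a =
      (fderiv ℝ (inverseMetric g₁) z.1 (P₁ z.1 (covFst d)) (covFst a),
        (φ z.1)⁻¹ • c • fderiv ℝ (inverseMetric g₂) z.2 (P₂ z.2 (covSnd d)) (covSnd a)) := by
  have hl := h.isLocalPair
  have hφ := (h.pos _ hz.1).ne'
  have h0 := (hl.differentiableAt_inverseMetric hz).hasFDerivAt.clm_apply (hasFDerivAt_const a z)
  have h1 : HasFDerivAt (fun y : V₁ × V₂ => inverseMetric g₁ y.1)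
      ((fderiv ℝ (inverseMetric g₁) z.1).comp (ContinuousLinearMap.fst ℝ V₁ V₂)) z :=
    (h.left.differentiableAt_inverseMetric hz.1).hasFDerivAt.comp z hasFDerivAt_fst
  have h2 : HasFDerivAt (fun y : V₁ × V₂ => inverseMetric g₂ y.2)
      ((fderiv ℝ (inverseMetric g₂) z.2).comp (ContinuousLinearMap.snd ℝ V₁ V₂)) z :=
    (h.right.differentiableAt_inverseMetric hz.2).hasFDerivAt.comp z hasFDerivAt_snd
  have hφd : HasFDerivAt φ (fderiv ℝ φ z.1) z.1 :=
    ((h.smooth.contDiffAt (h.left.isOpen.mem_nhds hz.1)).differentiableAt (by simp)).hasFDerivAt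
  have h5 : HasFDerivAt (fun y : V₁ × V₂ => (φ y.1)⁻¹)
      ((-(φ z.1 ^ 2)⁻¹) • (fderiv ℝ φ z.1).comp (ContinuousLinearMap.fst ℝ V₁ V₂)) z :=
    (hasDerivAt_inv hφ).comp_hasFDerivAt z (hφd.comp z hasFDerivAt_fst)
  have h3 := (h1.clm_apply (hasFDerivAt_const (covFst a) z)).prodMk
    (h5.smul (h2.clm_apply (hasFDerivAt_const (covSnd a) z)))
  have h4 := h3.congr_of_eventuallyEq (f₁ := fun y => inverseMetric g y a) (by
    filter_upwards [hl.isOpen.mem_nhds hz] with y hy using h.inverseMetric_apply hy a)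
  have := DFunLike.congr_fun (h0.unique h4) (P z d)
  simpa [h.sharp_apply z hz, h.casimir _ hz.1] using this

theorem christoffelForm_eq (h : IsLocalWarped P g P₁ g₁ U₁ P₂ g₂ U₂ φ c) (hz : z ∈ U₁ ×ˢ U₂)
    (a b d : V₁ × V₂ →L[ℝ] ℝ) :
    christoffelForm P g z a b d = christoffelForm P₁ g₁ z.1 (covFst a) (covFst b) (covFst d)
      + (φ z.1)⁻¹ * c * christoffelForm P₂ g₂ z.2 (covSnd a) (covSnd b) (covSnd d) := by
  simp only [christoffelForm, h.fderiv_inverseMetric_sharp hz, h.fderiv_sharp hz,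
    h.inverseMetric_apply hz, apply_eq_covFst_add_covSnd a, apply_eq_covFst_add_covSnd b,
    map_smul, smul_apply, smul_eq_mul]
  ring

/-- The factor `φ⁻¹` of the Christoffel form cancels against the `φ` gained by lowering the test
vector, so the connection does not see the warping at all. -/
theorem christoffel_eq (h : IsLocalWarped P g P₁ g₁ U₁ P₂ g₂ U₂ φ c) (hz : z ∈ U₁ ×ˢ U₂)
    (a b : V₁ × V₂ →L[ℝ] ℝ) :
    christoffel P g z a b =
      (christoffel P₁ g₁ z.1 (covFst a) (covFst b)).comp (ContinuousLinearMap.fst ℝ V₁ V₂)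
        + c • (christoffel P₂ g₂ z.2 (covSnd a) (covSnd b)).comp
          (ContinuousLinearMap.snd ℝ V₁ V₂) := by
  have hφ := (h.pos _ hz.1).ne'
  refine ContinuousLinearMap.ext fun v => ?_
  have e1 : covFst (g z v) = g₁ z.1 v.1 := by
    ext w; simp [h.metric_apply z hz]
  have e2 : covSnd (g z v) = φ z.1 • g₂ z.2 v.2 := by
    ext w; simp [h.metric_apply z hz]
  simp only [add_apply, smul_apply, ContinuousLinearMap.comp_apply, christoffel_apply,
    ContinuousLinearMap.coe_fst', ContinuousLinearMap.coe_snd', smul_eq_mul]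
  rw [h.christoffelForm_eq hz, e1, e2, christoffelForm_smul]
  field_simp

theorem fderiv_christoffel (h : IsLocalWarped P g P₁ g₁ U₁ P₂ g₂ U₂ φ c) (hz : z ∈ U₁ ×ˢ U₂)
    (a b d : V₁ × V₂ →L[ℝ] ℝ) :
    fderiv ℝ (fun y => christoffel P g y a b) z (P z d) =
      (fderiv ℝ (fun y => christoffel P₁ g₁ y (covFst a) (covFst b)) z.1
          (P₁ z.1 (covFst d))).comp (ContinuousLinearMap.fst ℝ V₁ V₂)
        + c ^ 2 • (fderiv ℝ (fun y => christoffel P₂ g₂ y (covSnd a) (covSnd b)) z.2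
          (P₂ z.2 (covSnd d))).comp (ContinuousLinearMap.snd ℝ V₁ V₂) := by
  have h1 : HasFDerivAt (fun y : V₁ × V₂ => christoffel P₁ g₁ y.1 (covFst a) (covFst b))
      ((fderiv ℝ (fun y => christoffel P₁ g₁ y (covFst a) (covFst b)) z.1).comp
        (ContinuousLinearMap.fst ℝ V₁ V₂)) z :=
    (h.left.differentiableAt_christoffel hz.1 (covFst a) (covFst b)).hasFDerivAt.comp z
      hasFDerivAt_fst
  have h2 : HasFDerivAt (fun y : V₁ × V₂ => christoffel P₂ g₂ y.2 (covSnd a) (covSnd b))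
      ((fderiv ℝ (fun y => christoffel P₂ g₂ y (covSnd a) (covSnd b)) z.2).comp
        (ContinuousLinearMap.snd ℝ V₁ V₂)) z :=
    (h.right.differentiableAt_christoffel hz.2 (covSnd a) (covSnd b)).hasFDerivAt.comp z
      hasFDerivAt_snd
  have h3 := (h1.clm_comp (hasFDerivAt_const (ContinuousLinearMap.fst ℝ V₁ V₂) z)).add
    ((h2.clm_comp (hasFDerivAt_const (ContinuousLinearMap.snd ℝ V₁ V₂) z)).const_smul c)
  have h4 := h3.congr_of_eventuallyEq (f₁ := fun y => christoffel P g y a b) (by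
    filter_upwards [h.isLocalPair.isOpen.mem_nhds hz] with y hy using h.christoffel_eq hy a b)
  rw [h4.fderiv]
  ext v
  · simp [h.sharp_apply z hz]
  · simp [h.sharp_apply z hz]; ring

/-- Each term on the second factor collects `c` twice: from a Christoffel tensor together with the
anchor, a second Christoffel tensor, or the bracket. -/
theorem curvature_eq (h : IsLocalWarped P g P₁ g₁ U₁ P₂ g₂ U₂ φ c) (hz : z ∈ U₁ ×ˢ U₂)
    (a b d : V₁ × V₂ →L[ℝ] ℝ) :
    curvature P g (fun _ => a) (fun _ => b) (fun _ => d) z =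
      (curvature P₁ g₁ (fun _ => covFst a) (fun _ => covFst b) (fun _ => covFst d) z.1).comp
          (ContinuousLinearMap.fst ℝ V₁ V₂)
        + (c ^ 2 • curvature P₂ g₂ (fun _ => covSnd a) (fun _ => covSnd b) (fun _ => covSnd d)
            z.2).comp (ContinuousLinearMap.snd ℝ V₁ V₂) := by
  rw [h.isLocalPair.curvature_const hz, h.left.curvature_const hz.1, h.right.curvature_const hz.2,
    h.fderiv_christoffel hz, h.fderiv_christoffel hz]
  simp only [h.christoffel_eq hz, h.constBracket_eq hz, ← ContinuousLinearMap.smul_comp,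
    covFst_comp_fst_add, covSnd_comp_fst_add, christoffel_smul_left, christoffel_smul_right]
  refine ContinuousLinearMap.ext fun v => ?_
  simp only [add_apply, sub_apply, smul_apply, ContinuousLinearMap.comp_apply, smul_eq_mul]
  ring

/-- The numerator of the sectional curvature of a local warped product with a Casimir warping
function. -/
theorem cometric_curvature_eq (h : IsLocalWarped P g P₁ g₁ U₁ P₂ g₂ U₂ φ c) (hz : z ∈ U₁ ×ˢ U₂)
    (a b : V₁ × V₂ →L[ℝ] ℝ) :
    cometric (g z) (curvature P g (fun _ => a) (fun _ => b) (fun _ => b) z) a =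
      cometric (g₁ z.1) (curvature P₁ g₁ (fun _ => covFst a) (fun _ => covFst b)
          (fun _ => covFst b) z.1) (covFst a)
        + (φ z.1)⁻¹ * c ^ 2 * cometric (g₂ z.2) (curvature P₂ g₂ (fun _ => covSnd a)
          (fun _ => covSnd b) (fun _ => covSnd b) z.2) (covSnd a) := by
  rw [h.isLocalPair.cometric_eq hz, h.left.cometric_eq hz.1, h.right.cometric_eq hz.2,
    h.inverseMetric_apply hz, h.curvature_eq hz]
  simp only [add_apply, smul_apply, ContinuousLinearMap.comp_apply, smul_eq_mul, map_smul,
    ContinuousLinearMap.coe_fst', ContinuousLinearMap.coe_snd']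
  ring

end IsLocalWarped

end LocalWarped

/-! ### From manifolds to charts, and sign conditions on the numerator. -/

section Manifold

set_option maxSynthPendingDepth 3

variable {E : Type*} [NormedAddCommGroup E] [NormedSpace ℝ E]
  {H : Type*} [TopologicalSpace H] (I : ModelWithCorners ℝ E H)
  {M : Type*} [TopologicalSpace M] [ChartedSpace H M]

theorem isInvertible_chartDeriv [IsManifold I 1 M] (p : M) {y : E}
    (hy : y ∈ (extChartAt I p).target) : (chartDeriv I p y).IsInvertible :=
  isInvertible_mfderiv_extChartAt ((extChartAt I p).map_target hy)

/-- The coordinate vector fields of a chart are smooth. -/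
theorem contMDiffOn_inverse_mfderiv_extChartAt [IsManifold I ∞ M] [IsManifold I 1 M]
    (p : M) (v : E) :
    ContMDiffOn I (I.prod 𝓘(ℝ, E)) ∞
      (fun x => Bundle.TotalSpace.mk' E (E := fun x : M => TangentSpace I x) x
        ((mfderiv I 𝓘(ℝ, E) (extChartAt I p) x).inverse v)) (chartAt H p).source := by
  have hb : (trivializationAt E (TangentSpace I) p).baseSet = (chartAt H p).source := by simp
  rw [(trivializationAt E (TangentSpace I) p).contMDiffOn_section_iff (chartAt H p).open_source
    hb.ge]
  refine contMDiffOn_const (c := v) |>.congr fun x hx => ?_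
  -- The tangent trivialization at `p` is the derivative of the chart at `p`, so the coordinate
  -- field reads as the constant `v`.
  have h1 : (trivializationAt E (TangentSpace I) p).continuousLinearMapAt ℝ x
      ((mfderiv I 𝓘(ℝ, E) (extChartAt I p) x).inverse v) = v := by
    rw [TangentBundle.continuousLinearMapAt_trivializationAt hx]
    exact (isInvertible_mfderiv_extChartAt (by rwa [extChartAt_source])).self_apply_inverse v
  rw [Bundle.Trivialization.continuousLinearMapAt_apply,
    Bundle.Trivialization.linearMapAt_apply, if_pos (by rwa [hb])] at h1
  exact h1

/-- In finite dimension smoothness may be tested on fixed vectors; the components are then `g`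
evaluated on smooth coordinate fields. -/
theorem contDiffOn_localMetric {E : Type*} [NormedAddCommGroup E] [NormedSpace ℝ E]
    [FiniteDimensional ℝ E] {M : Type*} [TopologicalSpace M] [ChartedSpace E M]
    [IsManifold 𝓘(ℝ, E) ∞ M] [IsManifold 𝓘(ℝ, E) 1 M]
    (g : Bundle.ContMDiffRiemannianMetric 𝓘(ℝ, E) ∞ E (fun x : M => TangentSpace 𝓘(ℝ, E) x))
    (p : M) :
    ContDiffOn ℝ ∞ (localMetric 𝓘(ℝ, E) g.inner p) (extChartAt 𝓘(ℝ, E) p).target := by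
  rw [contDiffOn_clm_apply]
  intro v
  rw [contDiffOn_clm_apply]
  intro w
  have h1 : ContMDiffOn 𝓘(ℝ, E) (𝓘(ℝ, E).prod 𝓘(ℝ, ℝ)) ∞
      (fun x : M => Bundle.TotalSpace.mk' ℝ (E := Bundle.Trivial M ℝ) x
        (g.inner x ((mfderiv 𝓘(ℝ, E) 𝓘(ℝ, E) (extChartAt 𝓘(ℝ, E) p) x).inverse v)
          ((mfderiv 𝓘(ℝ, E) 𝓘(ℝ, E) (extChartAt 𝓘(ℝ, E) p) x).inverse w)))
      (chartAt E p).source :=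
    ContMDiffOn.clm_bundle_apply₂ (F₁ := E) (F₂ := E) g.contMDiff.contMDiffOn
      (contMDiffOn_inverse_mfderiv_extChartAt 𝓘(ℝ, E) p v)
      (contMDiffOn_inverse_mfderiv_extChartAt 𝓘(ℝ, E) p w)
  have h2 : ContMDiffOn 𝓘(ℝ, E) 𝓘(ℝ, ℝ) ∞
      (fun x : M => g.inner x ((mfderiv 𝓘(ℝ, E) 𝓘(ℝ, E) (extChartAt 𝓘(ℝ, E) p) x).inverse v)
          ((mfderiv 𝓘(ℝ, E) 𝓘(ℝ, E) (extChartAt 𝓘(ℝ, E) p) x).inverse w))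
      (chartAt E p).source := fun x hx => by
    have := h1 x hx
    simp only [Bundle.contMDiffWithinAt_totalSpace] at this
    exact this.2
  rw [← contMDiffOn_iff_contDiffOn]
  refine h2.comp (contMDiffOn_extChartAt_symm p) fun y hy => ?_
  rw [← extChartAt_source 𝓘(ℝ, E)]
  exact (extChartAt 𝓘(ℝ, E) p).map_target hy

/-- A Poisson tensor and a Riemannian metric in the coordinates of a chart. -/
theorem isLocalPair_chart {E : Type*} [NormedAddCommGroup E] [NormedSpace ℝ E]
    [FiniteDimensional ℝ E] {M : Type*} [TopologicalSpace M] [ChartedSpace E M]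
    [IsManifold 𝓘(ℝ, E) ∞ M] [IsManifold 𝓘(ℝ, E) 1 M]
    {P : SharpField 𝓘(ℝ, E) M} (hP : IsPoisson 𝓘(ℝ, E) P)
    (g : Bundle.ContMDiffRiemannianMetric 𝓘(ℝ, E) ∞ E (fun x : M => TangentSpace 𝓘(ℝ, E) x))
    (p : M) :
    IsLocalPair (localSharp 𝓘(ℝ, E) P p) (localMetric 𝓘(ℝ, E) g.inner p)
      (extChartAt 𝓘(ℝ, E) p).target where
  isOpen := isOpen_extChartAt_target p
  smooth_sharp := hP.smooth p
  smooth_metric := contDiffOn_localMetric g p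
  skew y _ θ η := hP.skew _ (θ.comp (chartDeriv 𝓘(ℝ, E) p y)) (η.comp (chartDeriv 𝓘(ℝ, E) p y))
  symm y _ v w := g.symm _ _ _
  pos y hy v hv := by
    refine g.pos _ _ fun h0 => hv ?_
    have := (isInvertible_chartDeriv 𝓘(ℝ, E) p hy).self_apply_inverse v
    rw [← this]
    exact (congrArg (chartDeriv 𝓘(ℝ, E) p y) h0).trans (map_zero _)

/-- On a Hausdorff manifold every covector at a point is the differential of a smooth function. -/
theorem exists_differential_eq [FiniteDimensional ℝ E] [T2Space M] [IsManifold I ∞ M]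
    [IsManifold I 1 M] (p : M) (θ : Covector I p) :
    ∃ h : M → ℝ, ContMDiff I 𝓘(ℝ, ℝ) ∞ h ∧ differential I h p = θ := by
  obtain ⟨χ⟩ : Nonempty (SmoothBumpFunction I p) := inferInstance
  let θ' : E →L[ℝ] ℝ := θ
  -- The linear function `θ'` in the chart, cut off by a bump function equal to `1` near `p`; the
  -- chart at `p` has identity derivative at `p`.
  refine ⟨fun x => χ x • θ' (extChartAt I p x), χ.contMDiff_smul ?_, ?_⟩
  · exact θ'.contMDiff.comp_contMDiffOn contMDiffOn_extChartAt
  · have h1 : (fun x => χ x • θ' (extChartAt I p x)) =ᶠ[nhds p]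
        (θ' ∘ extChartAt I p) := by
      filter_upwards [χ.eventuallyEq_one] with x hx
      rw [hx]; simp
    unfold differential
    rw [h1.mfderiv_eq, mfderiv_comp p θ'.mdifferentiableAt
      (mdifferentiableAt_extChartAt (mem_chart_source H p)), mfderiv_extChartAt_self]
    rw [ContinuousLinearMap.mfderiv_eq]
    rfl

/-- Casimir functions are tested against globally defined functions, whose differentials exhaust the
covectors at `x`. This gives the pointwise form used in charts. -/
theorem IsCasimir.differential_sharp_eq_zero [FiniteDimensional ℝ E] [T2Space M]
    [IsManifold I ∞ M] [IsManifold I 1 M] {P : SharpField I M}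
    (hP : ∀ (x : M) (θ η : Covector I x), η (P x θ) = -θ (P x η)) {f : M → ℝ}
    (hf : IsCasimir I P f) (x : M) (θ : Covector I x) : differential I f x (P x θ) = 0 := by
  obtain ⟨h, hh, rfl⟩ := exists_differential_eq I x θ
  rw [hP x]
  exact neg_eq_zero.2 (hf h hh x)

variable [FiniteDimensional ℝ E]

/-- The numerator of the sectional curvature at `p`, in the chart at `p`. -/
def curvatureNumerator (P : SharpField I M) (g : MetricField I M) (p : M) (a b : E →L[ℝ] ℝ) : ℝ :=
  cometric (localMetric I g p (extChartAt I p p))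
    (curvature (localSharp I P p) (localMetric I g p) (fun _ => a) (fun _ => b) (fun _ => b)
      (extChartAt I p p)) a

theorem sectionalCurvature_eq [IsManifold I 1 M] (P : SharpField I M) (g : MetricField I M) (p : M)
    (a b : E →L[ℝ] ℝ) :
    sectionalCurvature I P g p a b = curvatureNumerator I P g p a b /
      (cometric (localMetric I g p (extChartAt I p p)) a a
          * cometric (localMetric I g p (extChartAt I p p)) b b
        - cometric (localMetric I g p (extChartAt I p p)) a b ^ 2) := by
  unfold sectionalCurvature
  rw [mfderiv_extChartAt_self]
  have : (ContinuousLinearMap.id ℝ E).inverse = ContinuousLinearMap.id ℝ E :=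
    ContinuousLinearMap.inverse_id
  erw [this]
  rfl

variable {I} in
-- Dropping independence is harmless, since the numerator is zero on dependent pairs, and it is
-- needed because restriction to a factor does not preserve independence.
theorem hasNonnegCurvature_iff [IsManifold I 1 M] {P : SharpField I M} {g : MetricField I M}
    {U : M → Set E} (hU : ∀ p, IsLocalPair (localSharp I P p) (localMetric I g p) (U p))
    (hmem : ∀ p, extChartAt I p p ∈ U p) :
    HasNonnegCurvature I P g ↔ ∀ p a b, 0 ≤ curvatureNumerator I P g p a b := by
  refine ⟨fun h p a b => ?_, fun h p (a : E →L[ℝ] ℝ) (b : E →L[ℝ] ℝ) hab => ?_⟩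
  · by_cases hab : LinearIndependent ℝ ![a, b]
    · have h1 := h p a b hab
      rw [sectionalCurvature_eq] at h1
      by_contra! hn
      exact (div_neg_of_neg_of_pos hn ((hU p).gram_pos (hmem p) hab)).not_ge h1
    · exact ((hU p).cometric_curvature_eq_zero (hmem p) hab).ge
  · exact (div_nonneg (h p a b) ((hU p).gram_pos (hmem p) hab).le).trans_eq
      (sectionalCurvature_eq I P g p a b).symm

variable {I} in
theorem hasNonposCurvature_iff [IsManifold I 1 M] {P : SharpField I M} {g : MetricField I M}
    {U : M → Set E} (hU : ∀ p, IsLocalPair (localSharp I P p) (localMetric I g p) (U p))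
    (hmem : ∀ p, extChartAt I p p ∈ U p) :
    HasNonposCurvature I P g ↔ ∀ p a b, curvatureNumerator I P g p a b ≤ 0 := by
  refine ⟨fun h p a b => ?_, fun h p (a : E →L[ℝ] ℝ) (b : E →L[ℝ] ℝ) hab => ?_⟩
  · by_cases hab : LinearIndependent ℝ ![a, b]
    · have h1 := h p a b hab
      rw [sectionalCurvature_eq] at h1
      by_contra! hn
      exact (div_pos hn ((hU p).gram_pos (hmem p) hab)).not_ge h1
    · exact ((hU p).cometric_curvature_eq_zero (hmem p) hab).le
  · exact (sectionalCurvature_eq I P g p a b).trans_le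
      (div_nonpos_of_nonpos_of_nonneg (h p a b) ((hU p).gram_pos (hmem p) hab).le)

end Manifold

/-! ### Warped products in product charts. -/

section WarpedProduct

set_option maxSynthPendingDepth 3

theorem inverse_prodMap {V₁ V₂ W₁ W₂ : Type*}
    [TopologicalSpace V₁] [AddCommGroup V₁] [Module ℝ V₁]
    [TopologicalSpace V₂] [AddCommGroup V₂] [Module ℝ V₂]
    [TopologicalSpace W₁] [AddCommGroup W₁] [Module ℝ W₁]
    [TopologicalSpace W₂] [AddCommGroup W₂] [Module ℝ W₂] {A : V₁ →L[ℝ] W₁} {B : V₂ →L[ℝ] W₂}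
    (hA : A.IsInvertible) (hB : B.IsInvertible) :
    (A.prodMap B).inverse = A.inverse.prodMap B.inverse := by
  refine ContinuousLinearMap.inverse_eq ?_ ?_
  · ext v <;> simp [hA.self_apply_inverse, hB.self_apply_inverse]
  · ext v <;> simp [hA.inverse_apply_self, hB.inverse_apply_self]

theorem differential_eq_fderiv_comp_chartDeriv {E : Type*} [NormedAddCommGroup E] [NormedSpace ℝ E]
    {M : Type*} [TopologicalSpace M] [ChartedSpace E M]
    [IsManifold 𝓘(ℝ, E) ∞ M] [IsManifold 𝓘(ℝ, E) 1 M] {f : M → ℝ}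
    (hf : ContMDiff 𝓘(ℝ, E) 𝓘(ℝ, ℝ) ∞ f) (p : M) {y : E}
    (hy : y ∈ (extChartAt 𝓘(ℝ, E) p).target) :
    differential 𝓘(ℝ, E) f ((extChartAt 𝓘(ℝ, E) p).symm y) =
      (fderiv ℝ (f ∘ (extChartAt 𝓘(ℝ, E) p).symm) y).comp (chartDeriv 𝓘(ℝ, E) p y) := by
  set x := (extChartAt 𝓘(ℝ, E) p).symm y with hx
  have hxs : x ∈ (extChartAt 𝓘(ℝ, E) p).source := (extChartAt 𝓘(ℝ, E) p).map_target hy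
  have hxy : extChartAt 𝓘(ℝ, E) p x = y := (extChartAt 𝓘(ℝ, E) p).right_inv hy
  have h1 : f =ᶠ[nhds x] (f ∘ (extChartAt 𝓘(ℝ, E) p).symm) ∘ extChartAt 𝓘(ℝ, E) p := by
    filter_upwards [extChartAt_source_mem_nhds' hxs] with z hz
    exact congrArg f ((extChartAt 𝓘(ℝ, E) p).left_inv hz).symm
  have h2 : MDifferentiableAt 𝓘(ℝ, E) 𝓘(ℝ, ℝ) (f ∘ (extChartAt 𝓘(ℝ, E) p).symm)
      (extChartAt 𝓘(ℝ, E) p x) := by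
    rw [hxy]
    exact (hf.comp_contMDiffOn (contMDiffOn_extChartAt_symm p)).contMDiffAt
      ((isOpen_extChartAt_target p).mem_nhds hy) |>.mdifferentiableAt (by simp)
  unfold differential chartDeriv
  rw [h1.mfderiv_eq, mfderiv_comp x h2
    (mdifferentiableAt_extChartAt (by rwa [extChartAt_source] at hxs)), hxy, mfderiv_eq_fderiv]
  rfl

variable {E₁ : Type*} [NormedAddCommGroup E₁] [NormedSpace ℝ E₁]
  {H₁ : Type*} [TopologicalSpace H₁] (I₁ : ModelWithCorners ℝ E₁ H₁)
  {M₁ : Type*} [TopologicalSpace M₁] [ChartedSpace H₁ M₁]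
  {E₂ : Type*} [NormedAddCommGroup E₂] [NormedSpace ℝ E₂]
  {H₂ : Type*} [TopologicalSpace H₂] (I₂ : ModelWithCorners ℝ E₂ H₂)
  {M₂ : Type*} [TopologicalSpace M₂] [ChartedSpace H₂ M₂]

theorem extChartAt_prod_symm_apply (p : M₁ × M₂) (z : E₁ × E₂) :
    (extChartAt (I₁.prod I₂) p).symm z =
      ((extChartAt I₁ p.1).symm z.1, (extChartAt I₂ p.2).symm z.2) := by
  rw [extChartAt_prod]; rfl

theorem warpedMetric_apply (g₁ : MetricField I₁ M₁) (f : M₁ → ℝ) (g₂ : MetricField I₂ M₂)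
    (x : M₁ × M₂) (v w : E₁ × E₂) :
    (show E₁ × E₂ →L[ℝ] E₁ × E₂ →L[ℝ] ℝ from warpedMetric I₁ I₂ g₁ f g₂ x) v w =
      (show E₁ →L[ℝ] E₁ →L[ℝ] ℝ from g₁ x.1) v.1 w.1
        + f x.1 ^ 2 * (show E₂ →L[ℝ] E₂ →L[ℝ] ℝ from g₂ x.2) v.2 w.2 := by
  unfold warpedMetric dfst dsnd
  rw [mfderiv_fst, mfderiv_snd]
  rfl

theorem warpedBivector_apply (P₁ : SharpField I₁ M₁) (ν : M₁ → ℝ) (P₂ : SharpField I₂ M₂)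
    (x : M₁ × M₂) (a : E₁ × E₂ →L[ℝ] ℝ) :
    (show (E₁ × E₂ →L[ℝ] ℝ) →L[ℝ] E₁ × E₂ from warpedBivector I₁ I₂ P₁ ν P₂ x) a =
      ((show (E₁ →L[ℝ] ℝ) →L[ℝ] E₁ from P₁ x.1) (covFst a),
        ν x.1 • (show (E₂ →L[ℝ] ℝ) →L[ℝ] E₂ from P₂ x.2) (covSnd a)) := by
  refine Prod.ext ?_ ?_
  · change (show (E₁ →L[ℝ] ℝ) →L[ℝ] E₁ from P₁ x.1) (covFst a) + ν x.1 • (0 : E₁) = _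
    simp
  · change (0 : E₂) + ν x.1 • (show (E₂ →L[ℝ] ℝ) →L[ℝ] E₂ from P₂ x.2) (covSnd a) = _
    simp

variable [IsManifold I₁ 1 M₁] [IsManifold I₂ 1 M₂]

theorem mfderiv_extChartAt_prod (p x : M₁ × M₂) (h1 : x.1 ∈ (extChartAt I₁ p.1).source)
    (h2 : x.2 ∈ (extChartAt I₂ p.2).source) :
    mfderiv (I₁.prod I₂) 𝓘(ℝ, E₁ × E₂) (extChartAt (I₁.prod I₂) p) x =
      (mfderiv I₁ 𝓘(ℝ, E₁) (extChartAt I₁ p.1) x.1).prodMap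
        (mfderiv I₂ 𝓘(ℝ, E₂) (extChartAt I₂ p.2) x.2) := by
  have e : (extChartAt (I₁.prod I₂) p : M₁ × M₂ → E₁ × E₂) =
      Prod.map (extChartAt I₁ p.1) (extChartAt I₂ p.2) := by
    rw [extChartAt_prod]; rfl
  rw [e, modelWithCornersSelf_prod, ← chartedSpaceSelf_prod]
  exact mfderiv_prodMap (mdifferentiableAt_extChartAt (by rwa [extChartAt_source] at h1))
    (mdifferentiableAt_extChartAt (by rwa [extChartAt_source] at h2))

theorem localMetric_warpedMetric (g₁ : MetricField I₁ M₁) (f : M₁ → ℝ) (g₂ : MetricField I₂ M₂)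
    (p : M₁ × M₂) {z : E₁ × E₂} (hz : z ∈ (extChartAt I₁ p.1).target ×ˢ (extChartAt I₂ p.2).target)
    (v w : E₁ × E₂) :
    localMetric (I₁.prod I₂) (warpedMetric I₁ I₂ g₁ f g₂) p z v w =
      localMetric I₁ g₁ p.1 z.1 v.1 w.1
        + f ((extChartAt I₁ p.1).symm z.1) ^ 2 * localMetric I₂ g₂ p.2 z.2 v.2 w.2 := by
  unfold localMetric chartDeriv
  rw [extChartAt_prod_symm_apply, mfderiv_extChartAt_prod I₁ I₂ p _
    ((extChartAt I₁ p.1).map_target hz.1) ((extChartAt I₂ p.2).map_target hz.2)]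
  have e := inverse_prodMap
    (isInvertible_chartDeriv I₁ p.1 hz.1) (isInvertible_chartDeriv I₂ p.2 hz.2)
  unfold chartDeriv at e
  erw [e]
  exact warpedMetric_apply I₁ I₂ g₁ f g₂ _ _ _

theorem localSharp_warpedBivector (P₁ : SharpField I₁ M₁) (ν : M₁ → ℝ) (P₂ : SharpField I₂ M₂)
    (p : M₁ × M₂) {z : E₁ × E₂} (hz : z ∈ (extChartAt I₁ p.1).target ×ˢ (extChartAt I₂ p.2).target)
    (a : E₁ × E₂ →L[ℝ] ℝ) :
    localSharp (I₁.prod I₂) (warpedBivector I₁ I₂ P₁ ν P₂) p z a =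
      (localSharp I₁ P₁ p.1 z.1 (covFst a),
        ν ((extChartAt I₁ p.1).symm z.1) • localSharp I₂ P₂ p.2 z.2 (covSnd a)) := by
  unfold localSharp chartDeriv
  rw [extChartAt_prod_symm_apply, mfderiv_extChartAt_prod I₁ I₂ p _
    ((extChartAt I₁ p.1).map_target hz.1) ((extChartAt I₂ p.2).map_target hz.2)]
  let A : E₁ →L[ℝ] E₁ := mfderiv I₁ 𝓘(ℝ, E₁) (extChartAt I₁ p.1) ((extChartAt I₁ p.1).symm z.1)
  let B : E₂ →L[ℝ] E₂ := mfderiv I₂ 𝓘(ℝ, E₂) (extChartAt I₂ p.2) ((extChartAt I₂ p.2).symm z.2)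
  have hA : covFst (a.comp (A.prodMap B)) = (covFst a).comp A := by ext; simp
  have hB : covSnd (a.comp (A.prodMap B)) = (covSnd a).comp B := by ext; simp
  exact (congrArg (A.prodMap B) (warpedBivector_apply I₁ I₂ P₁ ν P₂
    ((extChartAt I₁ p.1).symm z.1, (extChartAt I₂ p.2).symm z.2) (a.comp (A.prodMap B)))).trans
      (Prod.ext (congrArg (fun b => A ((show (E₁ →L[ℝ] ℝ) →L[ℝ] E₁ from P₁ _) b)) hA)
        ((map_smul B _ _).trans (congrArg (fun b => ν ((extChartAt I₁ p.1).symm z.1) •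
          B ((show (E₂ →L[ℝ] ℝ) →L[ℝ] E₂ from P₂ _) b)) hB)))

/-- A warped product in the coordinates of a product chart. -/
theorem isLocalWarped_chart {E₁ : Type*} [NormedAddCommGroup E₁] [NormedSpace ℝ E₁]
    [FiniteDimensional ℝ E₁] {M₁ : Type*} [TopologicalSpace M₁] [ChartedSpace E₁ M₁]
    [IsManifold 𝓘(ℝ, E₁) ∞ M₁] [IsManifold 𝓘(ℝ, E₁) 1 M₁] [T2Space M₁]
    {E₂ : Type*} [NormedAddCommGroup E₂] [NormedSpace ℝ E₂]
    [FiniteDimensional ℝ E₂] {M₂ : Type*} [TopologicalSpace M₂] [ChartedSpace E₂ M₂]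
    [IsManifold 𝓘(ℝ, E₂) ∞ M₂] [IsManifold 𝓘(ℝ, E₂) 1 M₂]
    (g₁ : Bundle.ContMDiffRiemannianMetric 𝓘(ℝ, E₁) ∞ E₁
      (fun x : M₁ => TangentSpace 𝓘(ℝ, E₁) x))
    (g₂ : Bundle.ContMDiffRiemannianMetric 𝓘(ℝ, E₂) ∞ E₂
      (fun x : M₂ => TangentSpace 𝓘(ℝ, E₂) x))
    {P₁ : SharpField 𝓘(ℝ, E₁) M₁} (hP₁ : IsPoisson 𝓘(ℝ, E₁) P₁)
    {P₂ : SharpField 𝓘(ℝ, E₂) M₂} (hP₂ : IsPoisson 𝓘(ℝ, E₂) P₂)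
    {f : M₁ → ℝ} (hf : ContMDiff 𝓘(ℝ, E₁) 𝓘(ℝ, ℝ) ∞ f) (hf_pos : ∀ x, 0 < f x)
    (hf_casimir : IsCasimir 𝓘(ℝ, E₁) P₁ f) {ν : M₁ → ℝ} {c : ℝ} (hν : ∀ x, ν x = c)
    (p : M₁ × M₂) :
    IsLocalWarped
      (localSharp (𝓘(ℝ, E₁).prod 𝓘(ℝ, E₂)) (warpedBivector 𝓘(ℝ, E₁) 𝓘(ℝ, E₂) P₁ ν P₂) p)
      (localMetric (𝓘(ℝ, E₁).prod 𝓘(ℝ, E₂))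
        (warpedMetric 𝓘(ℝ, E₁) 𝓘(ℝ, E₂) g₁.inner f g₂.inner) p)
      (localSharp 𝓘(ℝ, E₁) P₁ p.1) (localMetric 𝓘(ℝ, E₁) g₁.inner p.1)
      (extChartAt 𝓘(ℝ, E₁) p.1).target
      (localSharp 𝓘(ℝ, E₂) P₂ p.2) (localMetric 𝓘(ℝ, E₂) g₂.inner p.2)
      (extChartAt 𝓘(ℝ, E₂) p.2).target
      (fun y => f ((extChartAt 𝓘(ℝ, E₁) p.1).symm y) ^ 2) c := by
  have hsmooth : ContDiffOn ℝ ∞ (f ∘ (extChartAt 𝓘(ℝ, E₁) p.1).symm)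
      (extChartAt 𝓘(ℝ, E₁) p.1).target :=
    contMDiffOn_iff_contDiffOn.1 (hf.comp_contMDiffOn (contMDiffOn_extChartAt_symm p.1))
  refine
    { left := isLocalPair_chart hP₁ g₁ p.1
      right := isLocalPair_chart hP₂ g₂ p.2
      smooth := hsmooth.pow 2
      pos := fun y _ => pow_pos (hf_pos _) 2
      casimir := fun y hy a => ?_
      sharp_apply := fun z hz a => ?_
      metric_apply := fun z hz v w => localMetric_warpedMetric _ _ g₁.inner f g₂.inner p hz v w }
  · have h1 : fderiv ℝ (f ∘ (extChartAt 𝓘(ℝ, E₁) p.1).symm) y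
        (localSharp 𝓘(ℝ, E₁) P₁ p.1 y a) = 0 := by
      have h2 := hf_casimir.differential_sharp_eq_zero _ hP₁.skew
        ((extChartAt 𝓘(ℝ, E₁) p.1).symm y) (a.comp (chartDeriv 𝓘(ℝ, E₁) p.1 y))
      rwa [differential_eq_fderiv_comp_chartDeriv hf p.1 hy] at h2
    -- The differential of `f²` is a multiple of that of `f`, so it also kills the image of the
    -- sharp map.
    have h3 := ((hsmooth.contDiffAt ((isOpen_extChartAt_target p.1).mem_nhds hy)).differentiableAt
      (by simp)).hasFDerivAt.pow 2
    have h4 : fderiv ℝ (fun y => f ((extChartAt 𝓘(ℝ, E₁) p.1).symm y) ^ 2) y = _ := h3.fderiv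
    rw [h4]
    rw [smul_apply, h1, smul_zero]
  · rw [localSharp_warpedBivector _ _ _ _ _ _ hz, hν]

theorem curvatureNumerator_warped {E₁ : Type*} [NormedAddCommGroup E₁] [NormedSpace ℝ E₁]
    [FiniteDimensional ℝ E₁] {M₁ : Type*} [TopologicalSpace M₁] [ChartedSpace E₁ M₁]
    [IsManifold 𝓘(ℝ, E₁) ∞ M₁] [IsManifold 𝓘(ℝ, E₁) 1 M₁] [T2Space M₁]
    {E₂ : Type*} [NormedAddCommGroup E₂] [NormedSpace ℝ E₂]
    [FiniteDimensional ℝ E₂] {M₂ : Type*} [TopologicalSpace M₂] [ChartedSpace E₂ M₂]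
    [IsManifold 𝓘(ℝ, E₂) ∞ M₂] [IsManifold 𝓘(ℝ, E₂) 1 M₂]
    (g₁ : Bundle.ContMDiffRiemannianMetric 𝓘(ℝ, E₁) ∞ E₁
      (fun x : M₁ => TangentSpace 𝓘(ℝ, E₁) x))
    (g₂ : Bundle.ContMDiffRiemannianMetric 𝓘(ℝ, E₂) ∞ E₂
      (fun x : M₂ => TangentSpace 𝓘(ℝ, E₂) x))
    {P₁ : SharpField 𝓘(ℝ, E₁) M₁} (hP₁ : IsPoisson 𝓘(ℝ, E₁) P₁)
    {P₂ : SharpField 𝓘(ℝ, E₂) M₂} (hP₂ : IsPoisson 𝓘(ℝ, E₂) P₂)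
    {f : M₁ → ℝ} (hf : ContMDiff 𝓘(ℝ, E₁) 𝓘(ℝ, ℝ) ∞ f) (hf_pos : ∀ x, 0 < f x)
    (hf_casimir : IsCasimir 𝓘(ℝ, E₁) P₁ f) {ν : M₁ → ℝ} {c : ℝ} (hν : ∀ x, ν x = c)
    (p : M₁ × M₂) (a b : E₁ × E₂ →L[ℝ] ℝ) :
    curvatureNumerator (𝓘(ℝ, E₁).prod 𝓘(ℝ, E₂)) (warpedBivector 𝓘(ℝ, E₁) 𝓘(ℝ, E₂) P₁ ν P₂)
        (warpedMetric 𝓘(ℝ, E₁) 𝓘(ℝ, E₂) g₁.inner f g₂.inner) p a b =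
      curvatureNumerator 𝓘(ℝ, E₁) P₁ g₁.inner p.1 (covFst a) (covFst b)
        + (f p.1 ^ 2)⁻¹ * c ^ 2 *
          curvatureNumerator 𝓘(ℝ, E₂) P₂ g₂.inner p.2 (covSnd a) (covSnd b) := by
  have hz : extChartAt (𝓘(ℝ, E₁).prod 𝓘(ℝ, E₂)) p p ∈
      (extChartAt 𝓘(ℝ, E₁) p.1).target ×ˢ (extChartAt 𝓘(ℝ, E₂) p.2).target := by
    rw [extChartAt_prod]
    exact ⟨mem_extChartAt_target p.1, mem_extChartAt_target p.2⟩
  have h := (isLocalWarped_chart g₁ g₂ hP₁ hP₂ hf hf_pos hf_casimir hν p).cometric_curvature_eq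
    hz a b
  have e : extChartAt (𝓘(ℝ, E₁).prod 𝓘(ℝ, E₂)) p p =
      (extChartAt 𝓘(ℝ, E₁) p.1 p.1, extChartAt 𝓘(ℝ, E₂) p.2 p.2) := by
    rw [extChartAt_prod]; rfl
  unfold curvatureNumerator
  rw [h, e, extChartAt_to_inv]

end WarpedProduct

end ContravariantGeometry

end

/-! ### The two equivalences. -/

theorem corollary3p3
    {E₁ : Type*} [NormedAddCommGroup E₁] [NormedSpace ℝ E₁] [FiniteDimensional ℝ E₁]
    {E₂ : Type*} [NormedAddCommGroup E₂] [NormedSpace ℝ E₂] [FiniteDimensional ℝ E₂]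
    {M₁ : Type*} [TopologicalSpace M₁] [ChartedSpace E₁ M₁] [IsManifold 𝓘(ℝ, E₁) ∞ M₁]
    [T2Space M₁] [Nonempty M₁]
    {M₂ : Type*} [TopologicalSpace M₂] [ChartedSpace E₂ M₂] [IsManifold 𝓘(ℝ, E₂) ∞ M₂]
    [T2Space M₂] [Nonempty M₂]
    (g₁ : Bundle.ContMDiffRiemannianMetric 𝓘(ℝ, E₁) ∞ E₁
      (fun x : M₁ => TangentSpace 𝓘(ℝ, E₁) x))
    (g₂ : Bundle.ContMDiffRiemannianMetric 𝓘(ℝ, E₂) ∞ E₂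
      (fun x : M₂ => TangentSpace 𝓘(ℝ, E₂) x))
    (P₁ : ContravariantGeometry.SharpField 𝓘(ℝ, E₁) M₁)
    (hP₁ : ContravariantGeometry.IsPoisson 𝓘(ℝ, E₁) P₁)
    (P₂ : ContravariantGeometry.SharpField 𝓘(ℝ, E₂) M₂)
    (hP₂ : ContravariantGeometry.IsPoisson 𝓘(ℝ, E₂) P₂)
    (f : M₁ → ℝ) (hf : ContMDiff 𝓘(ℝ, E₁) 𝓘(ℝ, ℝ) ∞ f) (hf_pos : ∀ x, 0 < f x)
    (hf_casimir : ContravariantGeometry.IsCasimir 𝓘(ℝ, E₁) P₁ f)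
    (ν : M₁ → ℝ) (hν : ∃ c : ℝ, c ≠ 0 ∧ ∀ x, ν x = c) :
    (ContravariantGeometry.HasNonnegCurvature (𝓘(ℝ, E₁).prod 𝓘(ℝ, E₂))
        (ContravariantGeometry.warpedBivector 𝓘(ℝ, E₁) 𝓘(ℝ, E₂) P₁ ν P₂)
        (ContravariantGeometry.warpedMetric 𝓘(ℝ, E₁) 𝓘(ℝ, E₂) g₁.inner f g₂.inner) ↔
      ContravariantGeometry.HasNonnegCurvature 𝓘(ℝ, E₁) P₁ g₁.inner ∧
        ContravariantGeometry.HasNonnegCurvature 𝓘(ℝ, E₂) P₂ g₂.inner) ∧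
    (ContravariantGeometry.HasNonposCurvature (𝓘(ℝ, E₁).prod 𝓘(ℝ, E₂))
        (ContravariantGeometry.warpedBivector 𝓘(ℝ, E₁) 𝓘(ℝ, E₂) P₁ ν P₂)
        (ContravariantGeometry.warpedMetric 𝓘(ℝ, E₁) 𝓘(ℝ, E₂) g₁.inner f g₂.inner) ↔
      ContravariantGeometry.HasNonposCurvature 𝓘(ℝ, E₁) P₁ g₁.inner ∧
        ContravariantGeometry.HasNonposCurvature 𝓘(ℝ, E₂) P₂ g₂.inner) := by

  obtain ⟨c, hc, hν⟩ := hν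
  have : IsManifold 𝓘(ℝ, E₁) 1 M₁ := IsManifold.of_le (n := ∞) (by simp)
  have : IsManifold 𝓘(ℝ, E₂) 1 M₂ := IsManifold.of_le (n := ∞) (by simp)
  have hw := ContravariantGeometry.isLocalWarped_chart g₁ g₂ hP₁ hP₂ hf hf_pos hf_casimir hν
  have hnum :=
    ContravariantGeometry.curvatureNumerator_warped g₁ g₂ hP₁ hP₂ hf hf_pos hf_casimir hν
  have hl₁ := ContravariantGeometry.isLocalPair_chart hP₁ g₁
  have hl₂ := ContravariantGeometry.isLocalPair_chart hP₂ g₂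
  have hm₁ : ∀ p : M₁, extChartAt 𝓘(ℝ, E₁) p p ∈ (extChartAt 𝓘(ℝ, E₁) p).target :=
    fun p => mem_extChartAt_target p
  have hm₂ : ∀ p : M₂, extChartAt 𝓘(ℝ, E₂) p p ∈ (extChartAt 𝓘(ℝ, E₂) p).target :=
    fun p => mem_extChartAt_target p
  have hm : ∀ p : M₁ × M₂, extChartAt (𝓘(ℝ, E₁).prod 𝓘(ℝ, E₂)) p p ∈
      (extChartAt 𝓘(ℝ, E₁) p.1).target ×ˢ (extChartAt 𝓘(ℝ, E₂) p.2).target := fun p => by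
    rw [extChartAt_prod]
    exact ⟨hm₁ p.1, hm₂ p.2⟩
  have hpos : ∀ x, 0 < (f x ^ 2)⁻¹ * c ^ 2 := fun x => by
    have := hf_pos x
    positivity
  have h0₁ : ∀ p, ContravariantGeometry.curvatureNumerator 𝓘(ℝ, E₁) P₁ g₁.inner p 0 0 = 0 :=
    fun p => (hl₁ p).cometric_curvature_eq_zero (hm₁ p) fun h => h.ne_zero 0 rfl
  have h0₂ : ∀ p, ContravariantGeometry.curvatureNumerator 𝓘(ℝ, E₂) P₂ g₂.inner p 0 0 = 0 :=
    fun p => (hl₂ p).cometric_curvature_eq_zero (hm₂ p) fun h => h.ne_zero 0 rfl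
  -- Covectors pulled back from the first factor restrict to zero on the second, where the numerator
  -- vanishes.
  have hleft : ∀ (p : M₁ × M₂) (a b : E₁ →L[ℝ] ℝ),
      ContravariantGeometry.curvatureNumerator (𝓘(ℝ, E₁).prod 𝓘(ℝ, E₂))
        (ContravariantGeometry.warpedBivector 𝓘(ℝ, E₁) 𝓘(ℝ, E₂) P₁ ν P₂)
        (ContravariantGeometry.warpedMetric 𝓘(ℝ, E₁) 𝓘(ℝ, E₂) g₁.inner f g₂.inner) p
        (a.comp (ContinuousLinearMap.fst ℝ E₁ E₂)) (b.comp (ContinuousLinearMap.fst ℝ E₁ E₂)) =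
      ContravariantGeometry.curvatureNumerator 𝓘(ℝ, E₁) P₁ g₁.inner p.1 a b := fun p a b => by
    rw [hnum]
    simp [ContinuousLinearMap.comp_assoc, h0₂]
  have hright : ∀ (p : M₁ × M₂) (a b : E₂ →L[ℝ] ℝ),
      ContravariantGeometry.curvatureNumerator (𝓘(ℝ, E₁).prod 𝓘(ℝ, E₂))
        (ContravariantGeometry.warpedBivector 𝓘(ℝ, E₁) 𝓘(ℝ, E₂) P₁ ν P₂)
        (ContravariantGeometry.warpedMetric 𝓘(ℝ, E₁) 𝓘(ℝ, E₂) g₁.inner f g₂.inner) p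
        (a.comp (ContinuousLinearMap.snd ℝ E₁ E₂)) (b.comp (ContinuousLinearMap.snd ℝ E₁ E₂)) =
      (f p.1 ^ 2)⁻¹ * c ^ 2 *
        ContravariantGeometry.curvatureNumerator 𝓘(ℝ, E₂) P₂ g₂.inner p.2 a b := fun p a b => by
    rw [hnum]
    simp [ContinuousLinearMap.comp_assoc, h0₁]
  -- A point of one factor is needed to lift points of the other to the product.
  obtain ⟨x₁⟩ := ‹Nonempty M₁›
  obtain ⟨x₂⟩ := ‹Nonempty M₂›
  rw [ContravariantGeometry.hasNonnegCurvature_iff (fun p => (hw p).isLocalPair) hm,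
    ContravariantGeometry.hasNonnegCurvature_iff hl₁ hm₁,
    ContravariantGeometry.hasNonnegCurvature_iff hl₂ hm₂,
    ContravariantGeometry.hasNonposCurvature_iff (fun p => (hw p).isLocalPair) hm,
    ContravariantGeometry.hasNonposCurvature_iff hl₁ hm₁,
    ContravariantGeometry.hasNonposCurvature_iff hl₂ hm₂]
  refine ⟨⟨fun h => ⟨fun p a b => ?_, fun p a b => ?_⟩, fun h p a b => ?_⟩,
    ⟨fun h => ⟨fun p a b => ?_, fun p a b => ?_⟩, fun h p a b => ?_⟩⟩
  · exact (h (p, x₂) _ _).trans_eq (hleft (p, x₂) a b)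
  · exact nonneg_of_mul_nonneg_right ((h (x₁, p) _ _).trans_eq (hright (x₁, p) a b)) (hpos x₁)
  · rw [hnum]
    exact add_nonneg (h.1 _ _ _) (mul_nonneg (hpos _).le (h.2 _ _ _))
  · exact (hleft (p, x₂) a b).symm.trans_le (h (p, x₂) _ _)
  · exact nonpos_of_mul_nonpos_right ((hright (x₁, p) a b).symm.trans_le (h (x₁, p) _ _)) (hpos x₁)
  · rw [hnum]
    exact add_nonpos (h.1 _ _ _) (mul_nonpos_of_nonneg_of_nonpos (hpos _).le (h.2 _ _ _))
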